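/- Let $\mathbb T=\mathbb R/2\pi\mathbb Z$, $\hat f(k)=\int_{\mathbb T}f(x)e^{-ikx}\,dx$ and, for $s\ge 0$, $\|f\|_{H^s}^2=\sum_{k\in\mathbb Z}(1+|k|^{2s})|\hat f(k)|^2$. For $\nu>0$ consider $$\partial_t h=\partial_x\big((\partial_xh)^3-\partial_xh\big)-\nu\,\partial_x^4h\quad\text{on }[0,\infty)\times\mathbb T,\qquad h(0)=h_0 .\tag{1}$$ By a global solution of (1) with $h_0\in H^{1/2}(\mathbb T)$ we mean a function $h$ with $h\in C([0,\infty);H^{1/2}(\mathbb T))$, $t^{1/4}\partial_xh\in C([0,\infty);C(\mathbb T))$, $t^{1/4}h\in C([0,\infty);H^{3/2}(\mathbb T))$ (both weighted functions being $0$ at $t=0$), such that for all $t\ge0$ $$h(t)=e^{-\nu t\partial_x^4}h_0+\int_0^t\partial_x e^{-\nu(t-s)\partial_x^4}\big((\partial_xh)^3-\partial_xh\big)(s)\,ds ,$$ where $e^{-\nu t\partial_x^4}$ is the Fourier multiplier $e^{-\nu tk^4}$; for $t>0$, $h(t)$ denotes its $C^1$ representative. **Proposition 5.2.** Let $\nu_0>0$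 be fixed (for instance $\nu_0=1$), and let $h_0\in H^{1/2}(\mathbb T)$ be real-valued with mean zero. There is a constant $K_0$, depending only on $h_0$ (and on the fixed $\nu_0$), such that for every $0<\nu\le\nu_0$ and every global solution $h$ of (1) with initial data $h_0$, $$\limsup_{t\to\infty}\|\partial_xh(t)\|_{L^\infty(\mathbb T)}\le K_0 .$$ If in addition $h_0$ is even in $x$, then for every $0<\nu\le\nu_0$ and every such $h$, $$\limsup_{t\to\infty}\|\partial_xh(t)\|_{L^\infty(\mathbb T)}\le 1 .$$ -/

import Mathlib

open MeasureTheory Filter Topology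
open scoped ENNReal

namespace ThinFilm

/-- The torus `ℝ / 2πℤ`. Its `volume` is Lebesgue measure, of total mass `2π`. -/
abbrev Torus : Type := AddCircle (2 * Real.pi)

instance factTwoPiPos : Fact (0 < 2 * Real.pi) := ⟨Real.two_pi_pos⟩

/-- Fourier coefficient `f̂(k) = ∫_𝕋 f(x) e^{-ikx} dx` of a real function on the torus. -/
noncomputable def fhat (f : Torus → ℝ) (k : ℤ) : ℂ :=
  ∫ x : Torus, fourier (-k) x * (f x : ℂ)

/-- `fhat` is `2π` times Mathlib's normalised Fourier coefficient. -/
theorem fhat_eq (f : Torus → ℝ) (k : ℤ) :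
    fhat f k = (2 * Real.pi : ℝ) * fourierCoeff (fun x => (f x : ℂ)) k := by
  unfold fhat fourierCoeff
  rw [AddCircle.volume_eq_smul_haarAddCircle, integral_smul_measure,
    ENNReal.toReal_ofReal Real.two_pi_pos.le]
  simp

/-- The norm `‖f‖_{H^s} = (∑_k (1 + |k|^{2s}) |f̂(k)|²)^{1/2}`, as an extended nonnegative real. -/
noncomputable def sobolevENorm (s : ℝ) (f : Torus → ℝ) : ℝ≥0∞ :=
  (∑' k : ℤ, ENNReal.ofReal ((1 + |(k : ℝ)| ^ (2 * s)) * ‖fhat f k‖ ^ 2)) ^ (1 / 2 : ℝ)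

/-- Membership in `H^s(𝕋)`, `s ≥ 0`. -/
def MemSobolev (s : ℝ) (f : Torus → ℝ) : Prop :=
  MemLp f 2 volume ∧ sobolevENorm s f < ∞

/-- `u ∈ C([0,∞); H^s(𝕋))`. -/
def ContinuousInSobolev (s : ℝ) (u : ℝ → Torus → ℝ) : Prop :=
  (∀ t, 0 ≤ t → MemSobolev s (u t)) ∧
  ∀ t₀, 0 ≤ t₀ → Tendsto (fun t => sobolevENorm s (u t - u t₀)) (𝓝[Set.Ici 0] t₀) (𝓝 0)

/-- The spatial derivative `∂ₓ f` on the torus. -/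
noncomputable def dx (f : Torus → ℝ) : Torus → ℝ :=
  fun x => deriv (fun y : ℝ => f (x + (y : Torus))) 0

/-- The flux `((∂ₓ f)² - 1) ∂ₓ f = (∂ₓ f)³ - ∂ₓ f`. -/
noncomputable def flux (f : Torus → ℝ) : Torus → ℝ :=
  fun x => ((dx f x) ^ 2 - 1) * dx f x

/-- `h` is a global (mild) solution on `[0,∞) × 𝕋` of
`∂ₜ h = ∂ₓ((∂ₓ h)³ - ∂ₓ h) - ν ∂ₓ⁴ h`, `h(0) = h₀`:
it belongs to the solution space `h ∈ C_t H^{1/2}`, `t^{1/4} ∂ₓ h ∈ C_t C_x`,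
`t^{1/4} h ∈ C_t H^{3/2}` on `[0,∞)` (for `t > 0` the function `h(t)` is its `C¹` representative),
and it satisfies Duhamel's formula
`h(t) = e^{-νt∂ₓ⁴} h₀ + ∫₀ᵗ ∂ₓ e^{-ν(t-s)∂ₓ⁴} ((∂ₓ h)³ - ∂ₓ h)(s) ds`.
The propagator `e^{-νt∂ₓ⁴}` is the Fourier multiplier `e^{-νtk⁴}`, and the formula
is written for each Fourier coefficient. At `t = 0` the weighted functions
`t^{1/4} ∂ₓ h` and `t^{1/4} h` take the value `0`. -/
structure IsMildSolution (ν : ℝ) (h₀ : Torus → ℝ) (h : ℝ → Torus → ℝ) : Prop where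
  initial : h 0 =ᵐ[volume] h₀
  continuous_half : ContinuousInSobolev (1 / 2) h
  continuous_three_half :
    ContinuousInSobolev (3 / 2) (fun t x => t ^ (1 / 4 : ℝ) * h t x)
  contDiff : ∀ t, 0 < t → ContDiff ℝ 1 (fun y : ℝ => h t (y : Torus))
  continuous_grad :
    ContinuousOn (fun p : ℝ × Torus => p.1 ^ (1 / 4 : ℝ) * dx (h p.1) p.2)
      (Set.Ici 0 ×ˢ Set.univ)
  duhamel : ∀ t, 0 ≤ t → ∀ k : ℤ,
    fhat (h t) k =
      (Real.exp (-ν * t * (k : ℝ) ^ 4) : ℂ) * fhat h₀ k +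
        ∫ s in (0 : ℝ)..t,
          (Complex.I * (k : ℂ)) * (Real.exp (-ν * (t - s) * (k : ℝ) ^ 4) : ℂ) *
            fhat (flux (h s)) k

/-- `limsup_{t → ∞} ‖∂ₓ h(t)‖_{L^∞(𝕋)}`, as an extended nonnegative real. -/
noncomputable def limsupSlope (h : ℝ → Torus → ℝ) : ℝ≥0∞ :=
  limsup (fun t : ℝ => eLpNorm (dx (h t)) ∞ (volume : Measure Torus)) atTop

end ThinFilm

/-! The equation is the L² gradient flow of E(h) = ∫ (ν/2)(∂ₓ²h)² + ((∂ₓh)² - 1)²/4. In E only the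
term -(∂ₓh)²/2 is concave, and k² - νk⁴ ≤ 1/(4ν) (`quartic_le`) makes E semiconvex in L². Two
consequences carry the dynamics. The L² distance between two solutions grows at most exponentially
(`IsClassical.exists_sum_sq_sub_le`). An evolution variational inequality compares ‖h(s+τ) - h(s)‖²
with the energy drop (`IsClassical.exists_sum_sq_sub_le_integral_energy`).

Integrated in s, the variational inequality telescopes and shows that the velocity ∂ₜh is square
integrable over all late times and all space. Hence its integral over a late unit window is small.
Applying the distance estimate to h and its time shift by τ, then letting τ → 0, turns this into
pointwise decay: ‖∂ₜh(t)‖ → 0 in L² (`IsClassical.eventually_sum_sq_velocity_le`).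

Write u = ∂ₓh. Since ∂ₜh = ∂ₓ(u³ - u - ν∂ₓ²u), the quantity u³ - u - ν∂ₓ²u is uniformly close to its
mean when the velocity is small. At a maximum of u the term -ν∂ₓ²u is nonnegative, so u³ - u is at
most the mean flux plus a small error (`flux_le_of_isMax`); minima are symmetric. Testing with u
bounds the mean flux by 4 (`abs_meanFlux_le`), and since 2³ - 2 = 6 > 5 this forces |u| ≤ 2
eventually, whatever ν and h₀ are. Even data stay even by L² uniqueness; then the flux is odd, its
mean vanishes, and the bound becomes 1 + η for every η > 0.

Only H² bounds at positive times are used. Computations are therefore done on the frequencies |k| ≤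
N, where the truncation costs O(1/N), and N → ∞ is taken last. -/

namespace ThinFilm

open scoped ComplexConjugate

/-! ### Fourier coefficients on the torus and Parseval's identity -/

theorem isQuotientMap_coe : IsQuotientMap ((↑) : ℝ → Torus) :=
  QuotientAddGroup.isQuotientMap_mk _

theorem integrable_of_continuous {E : Type*} [NormedAddCommGroup E] {f : Torus → E}
    (hf : Continuous f) : Integrable f :=
  hf.integrable_of_hasCompactSupport (HasCompactSupport.of_compactSpace f)

theorem integrable_fourier_mul {f : Torus → ℝ} (hf : Integrable f) (k : ℤ) :
    Integrable (fun x : Torus => fourier (-k) x * (f x : ℂ)) := by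
  refine hf.ofReal.bdd_mul (c := 1) (fourier (-k)).continuous.aestronglyMeasurable ?_
  filter_upwards with x
  rw [fourier_apply]
  exact (Circle.norm_coe _).le

theorem fhat_sub {f g : Torus → ℝ} (hf : Integrable f) (hg : Integrable g) (k : ℤ) :
    fhat (f - g) k = fhat f k - fhat g k := by
  unfold fhat
  rw [← integral_sub (integrable_fourier_mul hf k) (integrable_fourier_mul hg k)]
  congr 1; ext x; simp [mul_sub]

theorem fhat_add {f g : Torus → ℝ} (hf : Integrable f) (hg : Integrable g) (k : ℤ) :
    fhat (f + g) k = fhat f k + fhat g k := by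
  unfold fhat
  rw [← integral_add (integrable_fourier_mul hf k) (integrable_fourier_mul hg k)]
  congr 1; ext x; simp [mul_add]

theorem fhat_const_mul (c : ℝ) (f : Torus → ℝ) (k : ℤ) :
    fhat (fun x => c * f x) k = c * fhat f k := by
  unfold fhat
  rw [← integral_const_mul]
  congr 1; ext x; push_cast; ring

theorem fhat_congr_ae {f g : Torus → ℝ} (h : f =ᵐ[volume] g) (k : ℤ) : fhat f k = fhat g k := by
  unfold fhat
  refine integral_congr_ae ?_
  filter_upwards [h] with x hx
  rw [hx]

theorem fhat_comp_neg (f : Torus → ℝ) (k : ℤ) : fhat (fun x => f (-x)) k = fhat f (-k) := by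
  unfold fhat
  rw [← integral_neg_eq_self]
  congr 1; ext x
  simp [fourier_apply]

/-- Parseval for the normalised coefficients, rescaled: each `fhat` carries a factor 2π and the
volume is 2π times Haar measure, which leaves a single 2π. -/
theorem hasSum_re_conj_fhat_mul {f g : Torus → ℝ} (hf : Continuous f) (hg : Continuous g) :
    HasSum (fun k => (conj (fhat f k) * fhat g k).re) (2 * Real.pi * ∫ x, f x * g x) := by
  let F : C(Torus, ℂ) := ⟨fun x => (f x : ℂ), by fun_prop⟩
  let G : C(Torus, ℂ) := ⟨fun x => (g x : ℂ), by fun_prop⟩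
  have h := (fourierBasis (T := 2 * Real.pi)).hasSum_inner_mul_inner
    (ContinuousMap.toLp 2 AddCircle.haarAddCircle ℂ F)
    (ContinuousMap.toLp 2 AddCircle.haarAddCircle ℂ G)
  rw [ContinuousMap.inner_toLp] at h
  have h2 := (Complex.hasSum_re (h.mul_left ((2 * Real.pi : ℝ) ^ 2 : ℂ)))
  have e1 : (fun k => (conj (fhat f k) * fhat g k).re) = fun i : ℤ =>
      (((2 * Real.pi : ℝ) ^ 2 : ℂ) * (inner ℂ (ContinuousMap.toLp 2 AddCircle.haarAddCircle ℂ F)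
        (fourierBasis i) * inner ℂ (fourierBasis i)
          (ContinuousMap.toLp 2 AddCircle.haarAddCircle ℂ G))).re := by
    ext k
    rw [← inner_conj_symm, ← HilbertBasis.repr_apply_apply, ← HilbertBasis.repr_apply_apply,
      fourierBasis_repr, fourierBasis_repr, fourierCoeff_toLp, fourierCoeff_toLp, fhat_eq, fhat_eq,
      map_mul, Complex.conj_ofReal]
    congr 1
    simp only [F, G, ContinuousMap.coe_mk]
    ring
  have e2 : 2 * Real.pi * ∫ x, f x * g x = (((2 * Real.pi : ℝ) ^ 2 : ℂ) *
      ∫ x : Torus, G x * conj (F x) ∂AddCircle.haarAddCircle).re := by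
    have : (∫ x : Torus, G x * conj (F x) ∂AddCircle.haarAddCircle) =
        ((∫ x : Torus, f x * g x ∂AddCircle.haarAddCircle : ℝ) : ℂ) := by
      rw [← integral_complex_ofReal]
      congr 1; ext x
      simp [F, G, mul_comm]
    rw [this, ← Complex.ofReal_pow, ← Complex.ofReal_mul, Complex.ofReal_re,
      AddCircle.volume_eq_smul_haarAddCircle, integral_smul_measure,
      ENNReal.toReal_ofReal Real.two_pi_pos.le]
    simp only [smul_eq_mul]
    ring
  rw [e1, e2]
  exact h2

theorem hasSum_sq_norm_fhat {f : Torus → ℝ} (hf : Continuous f) :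
    HasSum (fun k => ‖fhat f k‖ ^ 2) (2 * Real.pi * ∫ x, f x ^ 2) := by
  have h := hasSum_re_conj_fhat_mul hf hf
  simp only [← Complex.normSq_eq_conj_mul_self, Complex.ofReal_re, Complex.normSq_eq_norm_sq,
    ← sq] at h
  exact h

theorem sum_sq_norm_fhat_le {f : Torus → ℝ} (hf : Continuous f) (S : Finset ℤ) :
    ∑ k ∈ S, ‖fhat f k‖ ^ 2 ≤ 2 * Real.pi * ∫ x, f x ^ 2 :=
  sum_le_hasSum S (fun _ _ => by positivity) (hasSum_sq_norm_fhat hf)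

theorem re_conj_mul_le (z w : ℂ) : |(conj z * w).re| ≤ ‖z‖ * ‖w‖ := by
  calc |(conj z * w).re| ≤ ‖conj z * w‖ := Complex.abs_re_le_norm _
    _ = ‖z‖ * ‖w‖ := by rw [norm_mul, Complex.norm_conj]

/-- Parseval's identity up to the tail of the frequencies larger than `N`. -/
theorem le_sum_re_conj_fhat_mul {f g : Torus → ℝ} (hf : Continuous f) (hg : Continuous g) {X : ℝ}
    (hX : ∀ S : Finset ℤ, ∑ k ∈ S, (k : ℝ) ^ 2 * ‖fhat f k‖ ^ 2 ≤ X) {N : ℕ} (hN : 0 < N) :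
    2 * Real.pi * (∫ x, f x * g x) - (X + 2 * Real.pi * ∫ x, g x ^ 2) / N ≤
      ∑ k ∈ Finset.Icc (-(N : ℤ)) N, (conj (fhat f k) * fhat g k).re := by
  have hN' : (0 : ℝ) < N := by exact_mod_cast hN
  rw [sub_le_iff_le_add]
  refine le_of_tendsto (hasSum_re_conj_fhat_mul hf hg) ?_
  filter_upwards [eventually_ge_atTop (Finset.Icc (-(N : ℤ)) N)] with S hS
  rw [← Finset.sum_sdiff hS, add_comm]
  gcongr
  calc ∑ k ∈ S \ Finset.Icc (-(N : ℤ)) N, (conj (fhat f k) * fhat g k).re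
      ≤ ∑ k ∈ S \ Finset.Icc (-(N : ℤ)) N,
        ((k : ℝ) ^ 2 * ‖fhat f k‖ ^ 2 + ‖fhat g k‖ ^ 2) / N := by
        refine Finset.sum_le_sum fun k hk => ?_
        have hk' : (N : ℝ) ^ 2 ≤ (k : ℝ) ^ 2 := by
          have h1 := (Finset.mem_sdiff.1 hk).2
          rw [sq_le_sq]
          rw [Finset.mem_Icc, not_and_or] at h1
          have : (N : ℤ) ≤ |k| := by
            rcases h1 with h1 | h1
            · rw [le_abs]; right; omega
            · rw [le_abs]; left; omega
          rw [abs_of_pos hN']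
          exact_mod_cast this
        -- Beyond frequency N, Young's inequality gives N‖f̂‖‖ĝ‖ ≤ N²‖f̂‖² + ‖ĝ‖² ≤ k²‖f̂‖² + ‖ĝ‖².
        refine (le_abs_self _).trans ((re_conj_mul_le _ _).trans ?_)
        rw [le_div_iff₀ hN']
        have := mul_le_mul_of_nonneg_right hk' (sq_nonneg ‖fhat f k‖)
        nlinarith [sq_nonneg (N * ‖fhat f k‖ - ‖fhat g k‖), sq_nonneg (N * ‖fhat f k‖),
          sq_nonneg (‖fhat g k‖)]
    _ = (∑ k ∈ S \ Finset.Icc (-(N : ℤ)) N, (k : ℝ) ^ 2 * ‖fhat f k‖ ^ 2 +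
        ∑ k ∈ S \ Finset.Icc (-(N : ℤ)) N, ‖fhat g k‖ ^ 2) / N := by
        rw [← Finset.sum_div, Finset.sum_add_distrib]
    _ ≤ _ := by
        gcongr
        · exact hX _
        · exact sum_sq_norm_fhat_le hg _

/-! ### Spatial derivatives on the Fourier side -/

theorem dx_coe (f : Torus → ℝ) (y : ℝ) : dx f (y : Torus) = deriv (fun z : ℝ => f (z : Torus)) y := by
  unfold dx
  have := deriv_comp_const_add (fun z : ℝ => f (z : Torus)) y 0
  simpa using this

theorem continuous_of_contDiff {f : Torus → ℝ} (hf : ContDiff ℝ 1 (fun y : ℝ => f (y : Torus))) :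
    Continuous f :=
  isQuotientMap_coe.continuous_iff.2 hf.continuous

theorem continuous_dx {f : Torus → ℝ} (hf : ContDiff ℝ 1 (fun y : ℝ => f (y : Torus))) :
    Continuous (dx f) := by
  refine isQuotientMap_coe.continuous_iff.2 ?_
  have : (dx f ∘ ((↑) : ℝ → Torus)) = deriv (fun z : ℝ => f (z : Torus)) := by
    ext y; exact dx_coe f y
  rw [this]
  exact hf.continuous_deriv le_rfl

theorem continuous_flux {f : Torus → ℝ} (hf : ContDiff ℝ 1 (fun y : ℝ => f (y : Torus))) :
    Continuous (flux f) := by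
  have := continuous_dx hf
  unfold flux
  fun_prop

theorem fhat_eq_intervalIntegral (f : Torus → ℝ) (k : ℤ) :
    fhat f k = ∫ y in (0 : ℝ)..2 * Real.pi, fourier (-k) (y : Torus) * (f (y : Torus) : ℂ) := by
  have := AddCircle.intervalIntegral_preimage (2 * Real.pi) 0
    (fun x : Torus => fourier (-k) x * (f x : ℂ))
  rw [zero_add] at this
  exact this.symm

theorem hasDerivAt_fourier_neg_two_pi (k : ℤ) (y : ℝ) :
    HasDerivAt (fun y : ℝ => (fourier (-k) (y : Torus) : ℂ))
      (-(Complex.I * k) * fourier (-k) (y : Torus)) y := by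
  have h := hasDerivAt_fourier_neg (2 * Real.pi) k y
  convert h using 2
  have : (Real.pi : ℂ) ≠ 0 := by exact_mod_cast Real.pi_ne_zero
  push_cast
  field_simp

/-- The derivative of a function on the torus, read on the Fourier side. -/
theorem fhat_of_hasDerivAt {f g : Torus → ℝ} (hg : Continuous g)
    (h : ∀ y : ℝ, HasDerivAt (fun z : ℝ => f (z : Torus)) (g (y : Torus)) y) (k : ℤ) :
    fhat g k = Complex.I * k * fhat f k := by
  have hfc : Continuous (fun y : ℝ => f (y : Torus)) :=
    continuous_iff_continuousAt.2 fun y => (h y).continuousAt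
  have hgc : Continuous (fun y : ℝ => g (y : Torus)) := hg.comp (AddCircle.continuous_mk' _)
  have hec : Continuous (fun y : ℝ => (fourier (-k) (y : Torus) : ℂ)) :=
    (fourier (-k)).continuous.comp (AddCircle.continuous_mk' _)
  have hef : Continuous (fun y : ℝ => fourier (-k) (y : Torus) * (f (y : Torus) : ℂ)) :=
    hec.mul (Complex.continuous_ofReal.comp hfc)
  have heg : Continuous (fun y : ℝ => fourier (-k) (y : Torus) * (g (y : Torus) : ℂ)) :=
    hec.mul (Complex.continuous_ofReal.comp hgc)
  have hef' : Continuous (fun y : ℝ =>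
      -(Complex.I * k) * fourier (-k) (y : Torus) * (f (y : Torus) : ℂ)) := by
    simpa only [mul_assoc] using! hef.const_mul (-(Complex.I * k))
  have hp := intervalIntegral.integral_eq_sub_of_hasDerivAt (a := 0) (b := 2 * Real.pi)
    (f := fun y : ℝ => fourier (-k) (y : Torus) * (f (y : Torus) : ℂ))
    (fun y _ => (hasDerivAt_fourier_neg_two_pi k y).mul (h y).ofReal_comp)
    ((hef'.add heg).intervalIntegrable _ _)
  -- Periodicity removes the boundary terms of the integration by parts.
  have e0 : ((2 * Real.pi : ℝ) : Torus) = ((0 : ℝ) : Torus) := by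
    rw [AddCircle.coe_period]; rfl
  rw [e0, sub_self, intervalIntegral.integral_add
    (hef'.intervalIntegrable _ _)
    (heg.intervalIntegrable _ _)] at hp
  rw [fhat_eq_intervalIntegral, fhat_eq_intervalIntegral, ← intervalIntegral.integral_const_mul]
  simp only [mul_assoc, neg_mul] at hp
  rw [intervalIntegral.integral_neg, neg_add_eq_zero] at hp
  simp only [mul_assoc]
  exact hp.symm

theorem hasDerivAt_dx {f : Torus → ℝ} (hf : ContDiff ℝ 1 (fun y : ℝ => f (y : Torus))) (y : ℝ) :
    HasDerivAt (fun z : ℝ => f (z : Torus)) (dx f (y : Torus)) y := by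
  rw [dx_coe]
  exact (hf.differentiable one_ne_zero y).hasDerivAt

theorem fhat_dx {f : Torus → ℝ} (hf : ContDiff ℝ 1 (fun y : ℝ => f (y : Torus))) (k : ℤ) :
    fhat (dx f) k = Complex.I * k * fhat f k :=
  fhat_of_hasDerivAt (continuous_dx hf) (hasDerivAt_dx hf) k

/-! ### From Duhamel's formula to one differential equation per frequency -/

/-- Integrals over the torus of a jointly continuous function depend continuously on the
parameter. -/
theorem continuousOn_integral_torus {E : Type*} [NormedAddCommGroup E] [NormedSpace ℝ E]
    {F : ℝ → Torus → E} {s : Set ℝ}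
    (hF : ContinuousOn (fun p : ℝ × Torus => F p.1 p.2) (s ×ˢ Set.univ)) :
    ContinuousOn (fun t => ∫ x, F t x) s :=
  continuousOn_integral_of_compact_support (k := Set.univ) isCompact_univ hF
    fun _ x _ hx => absurd (Set.mem_univ x) hx

theorem continuousOn_fhat {F : ℝ → Torus → ℝ} {s : Set ℝ}
    (hF : ContinuousOn (fun p : ℝ × Torus => F p.1 p.2) (s ×ˢ Set.univ)) (k : ℤ) :
    ContinuousOn (fun t => fhat (F t) k) s := by
  refine continuousOn_integral_torus ?_
  exact ((fourier (-k)).continuous.comp continuous_snd).continuousOn.mul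
    (Complex.continuous_ofReal.comp_continuousOn hF)

/-- Solutions at positive times, described by the evolution of their Fourier coefficients. -/
structure IsClassical (ν : ℝ) (h : ℝ → Torus → ℝ) : Prop where
  contDiff : ∀ t, 0 < t → ContDiff ℝ 1 (fun y : ℝ => h t (y : Torus))
  continuousOn_dx : ContinuousOn (fun p : ℝ × Torus => dx (h p.1) p.2) (Set.Ioi 0 ×ˢ Set.univ)
  ode : ∀ t, 0 < t → ∀ k : ℤ, HasDerivAt (fun s => fhat (h s) k)
    (-ν * (k : ℝ) ^ 4 * fhat (h t) k + Complex.I * k * fhat (flux (h t)) k) t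

theorem norm_fhat_le {f : Torus → ℝ} {C : ℝ} (hf : ∀ x, |f x| ≤ C) (k : ℤ) :
    ‖fhat f k‖ ≤ C * (2 * Real.pi) := by
  have h := norm_integral_le_of_norm_le_const (μ := (volume : Measure Torus))
    (f := fun x : Torus => fourier (-k) x * (f x : ℂ)) (C := C)
    (Eventually.of_forall fun x => by
      rw [norm_mul, fourier_apply, Circle.norm_coe, one_mul, Complex.norm_real]
      exact hf x)
  have e : (volume : Measure Torus).real Set.univ = 2 * Real.pi := by
    rw [Measure.real, AddCircle.measure_univ, ENNReal.toReal_ofReal Real.two_pi_pos.le]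
  rw [e] at h
  exact h

theorem IsMildSolution.continuousOn_dx {ν : ℝ} {h₀ : Torus → ℝ} {h : ℝ → Torus → ℝ}
    (H : IsMildSolution ν h₀ h) :
    ContinuousOn (fun p : ℝ × Torus => dx (h p.1) p.2) (Set.Ioi 0 ×ˢ Set.univ) := by
  have h1 : ContinuousOn (fun p : ℝ × Torus => p.1 ^ (-(1 / 4) : ℝ)) (Set.Ioi 0 ×ˢ Set.univ) := by
    refine continuousOn_fst.rpow_const fun p hp => Or.inl ?_
    exact (ne_of_gt hp.1)
  have h2 := h1.mul (H.continuous_grad.mono (Set.prod_mono Set.Ioi_subset_Ici_self le_rfl))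
  refine h2.congr fun p hp => ?_
  have : 0 < p.1 := hp.1
  rw [Pi.mul_apply, ← mul_assoc, ← Real.rpow_add this]
  simp

theorem continuousOn_flux {h : ℝ → Torus → ℝ} {s : Set ℝ}
    (H : ContinuousOn (fun p : ℝ × Torus => dx (h p.1) p.2) (s ×ˢ Set.univ)) :
    ContinuousOn (fun p : ℝ × Torus => flux (h p.1) p.2) (s ×ˢ Set.univ) := by
  unfold flux
  fun_prop

/-- The weighted slope t^{1/4}∂ₓh is bounded up to t = 0, so the cubic flux blows up no faster than
t^{-3/4}. This is integrable, which makes the Duhamel integral differentiable in its upper limit. -/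
theorem IsMildSolution.norm_fhat_flux_le {ν : ℝ} {h₀ : Torus → ℝ} {h : ℝ → Torus → ℝ}
    (H : IsMildSolution ν h₀ h) (T : ℝ) :
    ∃ C, ∀ t ∈ Set.Ioc 0 T, ∀ k, ‖fhat (flux (h t)) k‖ ≤ C * t ^ (-(3 / 4) : ℝ) := by
  obtain ⟨B, hB⟩ := (isCompact_Icc (a := (0 : ℝ)) (b := T)).prod (isCompact_univ (X := Torus))
    |>.exists_bound_of_continuousOn
      (H.continuous_grad.mono (Set.prod_mono Set.Icc_subset_Ici_self le_rfl))
  refine ⟨(B ^ 3 + B * T ^ (1 / 2 : ℝ)) * (2 * Real.pi), fun t ht k => ?_⟩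
  have h0 : 0 < t := ht.1
  have key : ∀ x, |flux (h t) x| ≤ (B ^ 3 + B * T ^ (1 / 2 : ℝ)) * t ^ (-(3 / 4) : ℝ) := by
    intro x
    have hb := hB (t, x) ⟨⟨ht.1.le, ht.2⟩, trivial⟩
    simp only [Real.norm_eq_abs, abs_mul, abs_of_pos (Real.rpow_pos_of_pos h0 _)] at hb
    have hB0 : 0 ≤ B := le_trans (by positivity) hb
    set u := dx (h t) x
    set q := t ^ (1 / 4 : ℝ) with hq
    have hq0 : 0 < q := Real.rpow_pos_of_pos h0 _
    have e3 : t ^ (-(3 / 4) : ℝ) = (q ^ 3)⁻¹ := by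
      rw [hq, ← Real.rpow_natCast, ← Real.rpow_mul h0.le, ← Real.rpow_neg h0.le]; norm_num
    have e2 : q ^ 2 ≤ T ^ (1 / 2 : ℝ) := by
      rw [hq, ← Real.rpow_natCast, ← Real.rpow_mul h0.le]
      norm_num
      exact Real.rpow_le_rpow h0.le ht.2 (by norm_num)
    rw [e3, ← div_eq_mul_inv, le_div_iff₀ (by positivity)]
    have : |flux (h t) x| ≤ |u| ^ 3 + |u| := by
      unfold flux
      calc |(u ^ 2 - 1) * u| = |u ^ 3 - u| := by ring_nf
        _ ≤ |u ^ 3| + |u| := abs_sub _ _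
        _ = _ := by rw [abs_pow]
    calc |flux (h t) x| * q ^ 3 ≤ (|u| ^ 3 + |u|) * q ^ 3 := by gcongr
      _ = (q * |u|) ^ 3 + (q * |u|) * q ^ 2 := by ring
      _ ≤ B ^ 3 + B * T ^ (1 / 2 : ℝ) := by gcongr
  refine (norm_fhat_le key k).trans (le_of_eq ?_)
  ring

theorem IsMildSolution.isClassical {ν : ℝ} {h₀ : Torus → ℝ} {h : ℝ → Torus → ℝ}
    (H : IsMildSolution ν h₀ h) : IsClassical ν h := by
  refine ⟨H.contDiff, H.continuousOn_dx, fun t ht k => ?_⟩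
  have hFc := continuousOn_fhat (F := fun t => flux (h t)) (continuousOn_flux H.continuousOn_dx) k
  set G : ℝ → ℂ := fun s => Complex.I * k * (Real.exp (ν * s * (k : ℝ) ^ 4) : ℂ) *
    fhat (flux (h s)) k with hG
  have hGc : ContinuousOn G (Set.Ioi 0) := by
    refine ContinuousOn.mul (Continuous.continuousOn ?_) hFc
    fun_prop
  -- Pulling the factor e^{-νsk⁴} out of the integral leaves an integrand that does not depend on s.
  have hEq : ∀ s, 0 ≤ s → fhat (h s) k = (Real.exp (-ν * s * (k : ℝ) ^ 4) : ℂ) *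
      (fhat h₀ k + ∫ r in (0 : ℝ)..s, G r) := by
    intro s hs
    rw [H.duhamel s hs k, mul_add, ← intervalIntegral.integral_const_mul]
    congr 1
    refine intervalIntegral.integral_congr fun r _ => ?_
    have : Real.exp (-ν * (s - r) * (k : ℝ) ^ 4) =
        Real.exp (-ν * s * (k : ℝ) ^ 4) * Real.exp (ν * r * (k : ℝ) ^ 4) := by
      rw [← Real.exp_add]; congr 1; ring
    simp only [hG, this]
    push_cast
    ring
  have hint : IntervalIntegrable G volume 0 t := by
    obtain ⟨C, hC⟩ := H.norm_fhat_flux_le t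
    have h1 : IntervalIntegrable (fun s : ℝ => C * s ^ (-(3 / 4) : ℝ)) volume 0 t :=
      (intervalIntegral.intervalIntegrable_rpow' (by norm_num)).const_mul C
    have h2 : IntervalIntegrable (fun s => fhat (flux (h s)) k) volume 0 t := by
      refine h1.mono_fun ?_ ?_
      · rw [Set.uIoc_of_le ht.le]
        exact (hFc.mono Set.Ioc_subset_Ioi_self).aestronglyMeasurable measurableSet_Ioc
      · rw [Set.uIoc_of_le ht.le]
        filter_upwards [ae_restrict_mem measurableSet_Ioc] with s hs
        exact (hC s hs k).trans (le_abs_self _)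
    exact h2.continuousOn_mul (Continuous.continuousOn (by fun_prop))
  have hd : HasDerivAt (fun s => ∫ r in (0 : ℝ)..s, G r) (G t) t :=
    intervalIntegral.integral_hasDerivAt_right hint
      (hGc.stronglyMeasurableAtFilter isOpen_Ioi t ht)
      (hGc.continuousAt (Ioi_mem_nhds ht))
  have he : HasDerivAt (fun s : ℝ => (Real.exp (-ν * s * (k : ℝ) ^ 4) : ℂ))
      ((Real.exp (-ν * t * (k : ℝ) ^ 4) * (-ν * (k : ℝ) ^ 4) : ℝ) : ℂ) t := by
    refine HasDerivAt.ofReal_comp ?_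
    refine HasDerivAt.exp ?_
    simpa using ((hasDerivAt_id t).const_mul (-ν)).mul_const ((k : ℝ) ^ 4)
  have := he.mul (hd.const_add (fhat h₀ k))
  refine (this.congr_of_eventuallyEq ?_).congr_deriv ?_
  · filter_upwards [Ioi_mem_nhds ht] with s hs
    exact hEq s (le_of_lt hs)
  · rw [hEq t ht.le]
    have e : ((Real.exp (-ν * t * (k : ℝ) ^ 4) : ℝ) : ℂ) * (Real.exp (ν * t * (k : ℝ) ^ 4) : ℝ)
        = 1 := by
      rw [← Complex.ofReal_mul, ← Real.exp_add]
      simp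
    simp only [hG]
    push_cast at e ⊢
    linear_combination (Complex.I * k * fhat (flux (h t)) k) * e

/-! ### Invariance under time shifts and reflection -/

theorem IsClassical.shift {ν : ℝ} {h : ℝ → Torus → ℝ} (H : IsClassical ν h) {τ : ℝ}
    (hτ : 0 ≤ τ) : IsClassical ν (fun t => h (t + τ)) where
  contDiff t ht := H.contDiff _ (by positivity)
  continuousOn_dx := by
    refine H.continuousOn_dx.comp (f := fun p : ℝ × Torus => (p.1 + τ, p.2)) (by fun_prop) ?_
    rintro p ⟨hp, -⟩
    exact ⟨add_pos_of_pos_of_nonneg hp hτ, trivial⟩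
  ode t ht k := by
    exact (H.ode (t + τ) (by positivity) k).comp_add_const t τ

theorem dx_comp_neg (f : Torus → ℝ) (x : Torus) : dx (fun x => f (-x)) x = -dx f (-x) := by
  obtain ⟨y, rfl⟩ := QuotientAddGroup.mk_surjective x
  have h1 := dx_coe (fun x => f (-x)) y
  have h2 := dx_coe f (-y)
  have h3 := deriv_comp_neg (fun z : ℝ => f (z : Torus)) y
  simp only [AddCircle.coe_neg] at h1 h2 h3
  rw [h3] at h1
  exact h1.trans (congrArg Neg.neg h2.symm)

theorem flux_comp_neg (f : Torus → ℝ) (x : Torus) : flux (fun x => f (-x)) x = -flux f (-x) := by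
  unfold flux
  rw [dx_comp_neg]
  ring

theorem IsClassical.reflect {ν : ℝ} {h : ℝ → Torus → ℝ} (H : IsClassical ν h) :
    IsClassical ν (fun t x => h t (-x)) where
  contDiff t ht := by
    have := (H.contDiff t ht).comp (contDiff_neg (𝕜 := ℝ) (F := ℝ))
    simpa [Function.comp_def] using! this
  continuousOn_dx := by
    simp only [dx_comp_neg]
    refine (H.continuousOn_dx.comp (f := fun p : ℝ × Torus => (p.1, -p.2)) (by fun_prop) ?_).neg
    rintro p ⟨hp, -⟩
    exact ⟨hp, trivial⟩
  ode t ht k := by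
    have h1 : flux (fun x => h t (-x)) = fun x => (-1 : ℝ) * (fun x => flux (h t) (-x)) x := by
      ext x; rw [flux_comp_neg]; ring
    rw [h1, fhat_const_mul, fhat_comp_neg]
    simp only [fhat_comp_neg]
    refine (H.ode t ht (-k)).congr_deriv ?_
    push_cast
    ring

/-! ### Parabolic smoothing into H² -/

theorem hasDerivAt_sq_norm {c : ℝ → ℂ} {c' : ℂ} {t : ℝ} (h : HasDerivAt c c' t) :
    HasDerivAt (fun s => ‖c s‖ ^ 2) (2 * (conj (c t) * c').re) t := by
  have := h.norm_sq
  rw [Complex.inner] at this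
  rwa [mul_comm (conj (c t))]

/-- Bound on a compact time interval for a quantity depending continuously on time. -/
theorem exists_le_of_continuousOn_Ioi {f : ℝ → ℝ} (hf : ContinuousOn f (Set.Ioi 0)) {a : ℝ}
    (ha : 0 < a) (b : ℝ) : ∃ C, 0 ≤ C ∧ ∀ t ∈ Set.Icc a b, f t ≤ C := by
  obtain ⟨C, hC⟩ := isCompact_Icc.exists_bound_of_continuousOn
    (hf.mono fun t (ht : t ∈ Set.Icc a b) => lt_of_lt_of_le ha ht.1)
  exact ⟨|C|, abs_nonneg C, fun t ht => (le_abs_self _).trans ((hC t ht).trans (le_abs_self C))⟩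

theorem mul_exp_neg_sq_le_one (y : ℝ) : y * Real.exp (-y ^ 2) ≤ 1 := by
  rw [Real.exp_neg, ← div_eq_mul_inv, div_le_one (Real.exp_pos _)]
  nlinarith [Real.add_one_le_exp (y ^ 2), sq_nonneg (y - 1)]

theorem mul_exp_neg_le_one (y : ℝ) : y * Real.exp (-y) ≤ 1 := by
  rw [Real.exp_neg, ← div_eq_mul_inv, div_le_one (Real.exp_pos _)]
  linarith [Real.add_one_le_exp y]

/-- Smoothing: solutions are bounded in `H²` on compact intervals of positive times. -/
theorem IsClassical.exists_sum_pow_four_le {ν : ℝ} (hν : 0 < ν) {h : ℝ → Torus → ℝ}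
    (H : IsClassical ν h) {a : ℝ} (ha : 0 < a) (b : ℝ) :
    ∃ X, ∀ t ∈ Set.Icc a b, ∀ S : Finset ℤ, ∑ k ∈ S, (k : ℝ) ^ 4 * ‖fhat (h t) k‖ ^ 2 ≤ X := by
  have hFc := continuousOn_flux H.continuousOn_dx
  obtain ⟨K, hK0, hK⟩ := exists_le_of_continuousOn_Ioi
    ((continuousOn_integral_torus (F := fun t x => flux (h t) x ^ 2) (hFc.pow 2)).const_mul (2 * Real.pi)) (half_pos ha) b
  set L := K / (ν * √ν) with hL
  refine ⟨2 / (ν * a) * (2 * Real.pi * ∫ x, h (a / 2) x ^ 2) + L * 2 * √b, fun t ht S => ?_⟩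
  set s := a / 2 with hs
  have hs0 : 0 < s := half_pos ha
  have hst : s ≤ t := by linarith [ht.1]
  have hsν : √ν * √ν = ν := Real.mul_self_sqrt hν.le
  have hsν0 : 0 < √ν := Real.sqrt_pos.2 hν
  -- The propagator weight turns this into an H² norm at r = t and an L² norm at r = s. The forcing
  -- contributes at most L(t - r)^{-1/2} to the derivative, and the term 2L√(t - r) absorbs exactly
  -- that, so `Y` is nonincreasing.
  set Y : ℝ → ℝ := fun r => ∑ k ∈ S, (k : ℝ) ^ 4 * (Real.exp (-(ν * (k : ℝ) ^ 4 * (t - r))) *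
    ‖fhat (h r) k‖ ^ 2) + L * 2 * √(t - r) with hY
  have hderiv : ∀ r ∈ Set.Ioo s t, HasDerivAt Y (∑ k ∈ S, (k : ℝ) ^ 4 *
      (Real.exp (-(ν * (k : ℝ) ^ 4 * (t - r))) * (ν * (k : ℝ) ^ 4) * ‖fhat (h r) k‖ ^ 2 +
      Real.exp (-(ν * (k : ℝ) ^ 4 * (t - r))) * (2 * (conj (fhat (h r) k) *
        (-ν * (k : ℝ) ^ 4 * fhat (h r) k + Complex.I * k * fhat (flux (h r)) k)).re)) +
      L * 2 * (-1 / (2 * √(t - r)))) r := by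
    intro r hr
    have hr0 : 0 < r := hs0.trans hr.1
    refine HasDerivAt.add (HasDerivAt.fun_sum fun k _ => ?_) ?_
    · refine HasDerivAt.const_mul _ (HasDerivAt.mul (HasDerivAt.exp ?_)
        (hasDerivAt_sq_norm (H.ode r hr0 k)))
      have := (((hasDerivAt_id r).const_sub t).const_mul (ν * (k : ℝ) ^ 4)).neg
      simpa using! this
    · refine HasDerivAt.const_mul _ (HasDerivAt.sqrt ?_ (by linarith [hr.2]))
      simpa using (hasDerivAt_id r).const_sub t
  have hnonpos : ∀ r ∈ Set.Ioo s t, ∑ k ∈ S, (k : ℝ) ^ 4 *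
      (Real.exp (-(ν * (k : ℝ) ^ 4 * (t - r))) * (ν * (k : ℝ) ^ 4) * ‖fhat (h r) k‖ ^ 2 +
      Real.exp (-(ν * (k : ℝ) ^ 4 * (t - r))) * (2 * (conj (fhat (h r) k) *
        (-ν * (k : ℝ) ^ 4 * fhat (h r) k + Complex.I * k * fhat (flux (h r)) k)).re)) +
      L * 2 * (-1 / (2 * √(t - r))) ≤ 0 := by
    intro r hr
    have hr0 : 0 < r := hs0.trans hr.1
    have hρ : 0 < t - r := by linarith [hr.2]
    have hsq : 0 < √(t - r) := Real.sqrt_pos.2 hρ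
    have hsqsq : √(t - r) * √(t - r) = t - r := Real.mul_self_sqrt hρ.le
    have hterm : ∀ k ∈ S, (k : ℝ) ^ 4 *
      (Real.exp (-(ν * (k : ℝ) ^ 4 * (t - r))) * (ν * (k : ℝ) ^ 4) * ‖fhat (h r) k‖ ^ 2 +
      Real.exp (-(ν * (k : ℝ) ^ 4 * (t - r))) * (2 * (conj (fhat (h r) k) *
        (-ν * (k : ℝ) ^ 4 * fhat (h r) k + Complex.I * k * fhat (flux (h r)) k)).re)) ≤
        1 / (ν * √ν * √(t - r)) * ‖fhat (flux (h r)) k‖ ^ 2 := by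
      intro k _
      set c := fhat (h r) k
      set F := fhat (flux (h r)) k
      set e := Real.exp (-(ν * (k : ℝ) ^ 4 * (t - r))) with he
      have he0 : 0 < e := Real.exp_pos _
      have hre : (conj c * (-ν * (k : ℝ) ^ 4 * c + Complex.I * k * F)).re ≤
          -ν * (k : ℝ) ^ 4 * ‖c‖ ^ 2 + |(k : ℝ)| * (‖c‖ * ‖F‖) := by
        have e1 : conj c * (-ν * (k : ℝ) ^ 4 * c + Complex.I * k * F) =
            ((-ν * (k : ℝ) ^ 4 * ‖c‖ ^ 2 : ℝ) : ℂ) + conj c * (Complex.I * k * F) := by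
          have := Complex.conj_mul' c
          push_cast
          linear_combination (-ν * (k : ℂ) ^ 4) * this
        rw [e1, Complex.add_re, Complex.ofReal_re]
        gcongr
        refine (le_abs_self _).trans ((re_conj_mul_le _ _).trans (le_of_eq ?_))
        rw [norm_mul, norm_mul, Complex.norm_I, Complex.norm_intCast]
        ring
      -- The inequality y e^{-y²} ≤ 1 at y = k²√(ν(t - r)).
      have hexp : (k : ℝ) ^ 2 * e ≤ 1 / (√ν * √(t - r)) := by
        rw [le_div_iff₀ (by positivity)]
        have := mul_exp_neg_sq_le_one ((k : ℝ) ^ 2 * (√ν * √(t - r)))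
        have e2 : -((k : ℝ) ^ 2 * (√ν * √(t - r))) ^ 2 = -(ν * (k : ℝ) ^ 4 * (t - r)) := by
          rw [← hsν, ← hsqsq]
          simp only [hsν, hsqsq]
          rw [mul_pow, mul_pow, sq √ν, sq √(t - r), hsν, hsqsq]
          ring
        rw [e2, ← he] at this
        linarith
      -- Half of the dissipation offsets the derivative of the weight; the other half absorbs the
      -- flux by Young's inequality.
      have hyoung : ν * (k : ℝ) ^ 4 * ((k : ℝ) ^ 4 * ‖c‖ ^ 2) +
          (k : ℝ) ^ 4 * (2 * (-ν * (k : ℝ) ^ 4 * ‖c‖ ^ 2 + |(k : ℝ)| * (‖c‖ * ‖F‖))) ≤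
          1 / ν * ((k : ℝ) ^ 2 * ‖F‖ ^ 2) := by
        have hk : |(k : ℝ)| ^ 2 = (k : ℝ) ^ 2 := sq_abs _
        have hk4 : (k : ℝ) ^ 4 = |(k : ℝ)| ^ 4 := by rw [← abs_pow, abs_of_nonneg (by positivity)]
        rw [one_div, inv_mul_eq_div, le_div_iff₀ hν, hk4, ← hk]
        nlinarith [sq_nonneg (ν * |(k : ℝ)| ^ 4 * ‖c‖ - |(k : ℝ)| * ‖F‖)]
      calc _ = e * (ν * (k : ℝ) ^ 4 * ((k : ℝ) ^ 4 * ‖c‖ ^ 2) + (k : ℝ) ^ 4 * (2 *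
            (conj c * (-ν * (k : ℝ) ^ 4 * c + Complex.I * k * F)).re)) := by ring
        _ ≤ e * (1 / ν * ((k : ℝ) ^ 2 * ‖F‖ ^ 2)) := by
            refine mul_le_mul_of_nonneg_left (le_trans ?_ hyoung) he0.le
            gcongr
        _ = 1 / ν * ((k : ℝ) ^ 2 * e) * ‖F‖ ^ 2 := by ring
        _ ≤ 1 / ν * (1 / (√ν * √(t - r))) * ‖F‖ ^ 2 := by gcongr
        _ = _ := by
            rw [one_div_mul_one_div, mul_assoc]
    have hsum := Finset.sum_le_sum hterm
    rw [← Finset.mul_sum] at hsum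
    have hF := (sum_sq_norm_fhat_le (continuous_flux (H.contDiff r hr0)) S).trans
      (hK r ⟨hr.1.le, hr.2.le.trans ht.2⟩)
    have h3 : 1 / (ν * √ν * √(t - r)) * ∑ k ∈ S, ‖fhat (flux (h r)) k‖ ^ 2 ≤
        1 / (ν * √ν * √(t - r)) * K := by gcongr
    have h4 : 1 / (ν * √ν * √(t - r)) * K + L * 2 * (-1 / (2 * √(t - r))) = 0 := by
      rw [hL]; field_simp; ring
    linarith
  have hcont : ContinuousOn Y (Set.Icc s t) := by
    refine ContinuousOn.add (continuousOn_finsetSum _ fun k _ => ?_) (by fun_prop)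
    refine continuousOn_const.mul (ContinuousOn.mul (by fun_prop) ?_)
    intro r hr
    exact (hasDerivAt_sq_norm (H.ode r (hs0.trans_le hr.1) k)).continuousAt.continuousWithinAt
  have hanti : AntitoneOn Y (Set.Icc s t) := by
    refine antitoneOn_of_deriv_nonpos (convex_Icc s t) hcont ?_ ?_
    · rw [interior_Icc]
      exact fun r hr => (hderiv r hr).differentiableAt.differentiableWithinAt
    · rw [interior_Icc]
      intro r hr
      rw [(hderiv r hr).deriv]
      exact hnonpos r hr
  have hfin := hanti ⟨le_rfl, hst⟩ ⟨hst, le_rfl⟩ hst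
  simp only [hY, sub_self, mul_zero, neg_zero, Real.exp_zero, one_mul, Real.sqrt_zero, add_zero]
    at hfin
  refine hfin.trans (add_le_add ?_ ?_)
  -- At the initial time s = a/2 the elapsed time is at least a/2, so y e^{-y} ≤ 1 bounds
  -- k⁴e^{-νk⁴(t-s)} by 2/(νa).
  · have hterm : ∀ k ∈ S, (k : ℝ) ^ 4 * (Real.exp (-(ν * (k : ℝ) ^ 4 * (t - s))) *
        ‖fhat (h s) k‖ ^ 2) ≤ 2 / (ν * a) * ‖fhat (h s) k‖ ^ 2 := by
      intro k _
      rw [← mul_assoc]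
      gcongr
      rw [le_div_iff₀ (by positivity)]
      have := mul_exp_neg_le_one (ν * (k : ℝ) ^ 4 * (t - s))
      have h2 : a / 2 ≤ t - s := by linarith [ht.1]
      have h3 : 0 ≤ ν * (k : ℝ) ^ 4 * Real.exp (-(ν * (k : ℝ) ^ 4 * (t - s))) := by positivity
      nlinarith
    refine (Finset.sum_le_sum hterm).trans ?_
    rw [← Finset.mul_sum]
    gcongr
    exact sum_sq_norm_fhat_le (continuous_of_contDiff (H.contDiff s hs0)) S
  · have hL0 : 0 ≤ L := by positivity
    gcongr
    linarith [ht.2]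

/-! ### Semiconvexity and L² stability -/

/-- The frequencies `-N, …, N`. -/
noncomputable def freq (N : ℕ) : Finset ℤ := Finset.Icc (-(N : ℤ)) N

theorem freq_mono {K N : ℕ} (h : K ≤ N) : freq K ⊆ freq N := by
  intro k hk
  unfold freq at *
  rw [Finset.mem_Icc] at *
  omega

theorem IsClassical.exists_abs_dx_le {ν : ℝ} {h : ℝ → Torus → ℝ} (H : IsClassical ν h) {a : ℝ}
    (ha : 0 < a) (b : ℝ) : ∃ B, 0 ≤ B ∧ ∀ t ∈ Set.Icc a b, ∀ x, |dx (h t) x| ≤ B := by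
  obtain ⟨B, hB⟩ := (isCompact_Icc (a := a) (b := b)).prod (isCompact_univ (X := Torus))
    |>.exists_bound_of_continuousOn (H.continuousOn_dx.mono (Set.prod_mono
      (fun t ht => lt_of_lt_of_le ha ht.1) le_rfl))
  exact ⟨|B|, abs_nonneg B, fun t ht x => (hB (t, x) ⟨ht, trivial⟩).trans (le_abs_self B)⟩

theorem integral_sq_le {f : Torus → ℝ} {M : ℝ} (h : ∀ x, |f x| ≤ M) :
    ∫ x, f x ^ 2 ≤ M ^ 2 * (2 * Real.pi) := by
  have h := norm_integral_le_of_norm_le_const (μ := (volume : Measure Torus))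
    (f := fun x : Torus => f x ^ 2) (C := M ^ 2)
    (Eventually.of_forall fun x => by
      rw [Real.norm_eq_abs, abs_pow]
      exact pow_le_pow_left₀ (abs_nonneg _) (h x) 2)
  have e : (volume : Measure Torus).real Set.univ = 2 * Real.pi := by
    rw [Measure.real, AddCircle.measure_univ, ENNReal.toReal_ofReal Real.two_pi_pos.le]
  rw [e] at h
  exact (le_abs_self _).trans h

/-- Completing the square in k². This is the sole source of the semiconvexity constant: the
fourth-order term dominates the backward diffusion up to a multiple of the L² norm. -/
theorem quartic_le {ν : ℝ} (hν : 0 < ν) (k : ℝ) : k ^ 2 - 1 / (4 * ν) ≤ ν * k ^ 4 := by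
  rw [sub_le_iff_le_add, ← sub_nonneg]
  have : ν * k ^ 4 + 1 / (4 * ν) - k ^ 2 = (2 * ν * k ^ 2 - 1) ^ 2 / (4 * ν) := by
    field_simp; ring
  rw [this]
  positivity

/-- Integration by parts, one frequency at a time. -/
theorem re_conj_mul_I (v F : ℂ) (k : ℤ) :
    (conj v * (Complex.I * k * F)).re = -(conj (Complex.I * k * v) * F).re := by
  have : conj v * (Complex.I * k * F) = -(conj (Complex.I * k * v) * F) := by
    rw [map_mul, map_mul, Complex.conj_I, map_intCast]; ring
  rw [this, Complex.neg_re]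

theorem re_conj_mul_add (z a b : ℂ) :
    (conj z * (a + b)).re = (conj z * a).re + (conj z * b).re := by
  rw [mul_add, Complex.add_re]

theorem re_conj_mul_ofReal (z a : ℂ) (r : ℝ) :
    (conj z * (r * a)).re = r * (conj z * a).re := by
  rw [mul_left_comm, Complex.re_ofReal_mul]

theorem re_conj_mul_self (z : ℂ) : (conj z * z).re = ‖z‖ ^ 2 := by
  rw [← Complex.normSq_eq_conj_mul_self, Complex.ofReal_re, Complex.normSq_eq_norm_sq]

theorem sq_norm_sub_le (z w : ℂ) : ‖z - w‖ ^ 2 ≤ 2 * ‖z‖ ^ 2 + 2 * ‖w‖ ^ 2 := by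
  have := norm_sub_le z w
  nlinarith [norm_nonneg (z - w), sq_nonneg (‖z‖ - ‖w‖)]

theorem sq_norm_I_mul (k : ℤ) (z : ℂ) : ‖Complex.I * k * z‖ ^ 2 = (k : ℝ) ^ 2 * ‖z‖ ^ 2 := by
  rw [norm_mul, norm_mul, Complex.norm_I, Complex.norm_intCast, mul_pow, mul_pow, sq_abs]
  ring

theorem fhat_dx_sub {f g : Torus → ℝ} (hf : ContDiff ℝ 1 (fun y : ℝ => f (y : Torus)))
    (hg : ContDiff ℝ 1 (fun y : ℝ => g (y : Torus))) (k : ℤ) :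
    fhat (dx f - dx g) k = Complex.I * k * (fhat f k - fhat g k) := by
  rw [fhat_sub (integrable_of_continuous (continuous_dx hf))
    (integrable_of_continuous (continuous_dx hg)), fhat_dx hf, fhat_dx hg]
  ring

theorem sum_sq_mul_fhat_dx_sub_le {f g : Torus → ℝ}
    (hf : ContDiff ℝ 1 (fun y : ℝ => f (y : Torus)))
    (hg : ContDiff ℝ 1 (fun y : ℝ => g (y : Torus))) {X Y : ℝ}
    (hX : ∀ S : Finset ℤ, ∑ k ∈ S, (k : ℝ) ^ 4 * ‖fhat f k‖ ^ 2 ≤ X)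
    (hY : ∀ S : Finset ℤ, ∑ k ∈ S, (k : ℝ) ^ 4 * ‖fhat g k‖ ^ 2 ≤ Y) (S : Finset ℤ) :
    ∑ k ∈ S, (k : ℝ) ^ 2 * ‖fhat (dx f - dx g) k‖ ^ 2 ≤ 2 * X + 2 * Y := by
  calc ∑ k ∈ S, (k : ℝ) ^ 2 * ‖fhat (dx f - dx g) k‖ ^ 2
      ≤ ∑ k ∈ S, (2 * ((k : ℝ) ^ 4 * ‖fhat f k‖ ^ 2) + 2 * ((k : ℝ) ^ 4 * ‖fhat g k‖ ^ 2)) := by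
        refine Finset.sum_le_sum fun k _ => ?_
        rw [fhat_dx_sub hf hg, sq_norm_I_mul]
        have := mul_le_mul_of_nonneg_left (sq_norm_sub_le (fhat f k) (fhat g k))
          (by positivity : 0 ≤ (k : ℝ) ^ 4)
        calc _ = (k : ℝ) ^ 4 * ‖fhat f k - fhat g k‖ ^ 2 := by ring
          _ ≤ _ := this
          _ = _ := by ring
    _ = 2 * ∑ k ∈ S, (k : ℝ) ^ 4 * ‖fhat f k‖ ^ 2 +
        2 * ∑ k ∈ S, (k : ℝ) ^ 4 * ‖fhat g k‖ ^ 2 := by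
        rw [Finset.sum_add_distrib, Finset.mul_sum, Finset.mul_sum]
    _ ≤ _ := by gcongr <;> solve_by_elim

/-- Exponential control of the `L²` distance of two solutions, up to high frequencies. -/
theorem IsClassical.exists_sum_sq_sub_le {ν : ℝ} (hν : 0 < ν) {h g : ℝ → Torus → ℝ}
    (H : IsClassical ν h) (G : IsClassical ν g) {a : ℝ} (ha : 0 < a) (b : ℝ) :
    ∃ C, 0 ≤ C ∧ ∀ N : ℕ, 0 < N → ∀ s t, a ≤ s → s ≤ t → t ≤ b →
      Real.exp (-(t / (2 * ν))) * ∑ k ∈ freq N, ‖fhat (h t) k - fhat (g t) k‖ ^ 2 ≤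
      Real.exp (-(s / (2 * ν))) * (∑ k ∈ freq N, ‖fhat (h s) k - fhat (g s) k‖ ^ 2) +
        (t - s) * (C / N) := by
  obtain ⟨X, hX⟩ := H.exists_sum_pow_four_le hν ha b
  obtain ⟨Y, hY⟩ := G.exists_sum_pow_four_le hν ha b
  obtain ⟨A, hA0, hA⟩ := H.exists_abs_dx_le ha b
  obtain ⟨B, hB0, hB⟩ := G.exists_abs_dx_le ha b
  set Q := 2 * Real.pi * ((2 * (A ^ 3 + B ^ 3)) ^ 2 * (2 * Real.pi)) with hQ
  refine ⟨|2 * X + 2 * Y + Q|, abs_nonneg _, fun N hN s t hs hst ht => ?_⟩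
  set C := |2 * X + 2 * Y + Q|
  have hN' : (0 : ℝ) < N := by exact_mod_cast hN
  set V : ℝ → ℤ → ℂ := fun r k =>
    (-ν * (k : ℝ) ^ 4 * fhat (h r) k + Complex.I * k * fhat (flux (h r)) k) -
      (-ν * (k : ℝ) ^ 4 * fhat (g r) k + Complex.I * k * fhat (flux (g r)) k) with hV
  have hd : ∀ r, 0 < r → HasDerivAt (fun r => Real.exp (-(r / (2 * ν))) *
      (∑ k ∈ freq N, ‖fhat (h r) k - fhat (g r) k‖ ^ 2) - r * (C / N))
      (Real.exp (-(r / (2 * ν))) * (-(1 / (2 * ν))) *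
        (∑ k ∈ freq N, ‖fhat (h r) k - fhat (g r) k‖ ^ 2) +
        Real.exp (-(r / (2 * ν))) * (∑ k ∈ freq N,
          2 * (conj (fhat (h r) k - fhat (g r) k) * V r k).re) - 1 * (C / N)) r := by
    intro r hr
    refine HasDerivAt.sub (HasDerivAt.mul (HasDerivAt.exp ?_) (HasDerivAt.fun_sum fun k _ => ?_))
      ((hasDerivAt_id r).mul_const _)
    · exact ((hasDerivAt_id r).div_const _).neg
    · exact hasDerivAt_sq_norm ((H.ode r hr k).sub (G.ode r hr k))
  have hle : ∀ r ∈ Set.Ioo s t, Real.exp (-(r / (2 * ν))) * (-(1 / (2 * ν))) *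
        (∑ k ∈ freq N, ‖fhat (h r) k - fhat (g r) k‖ ^ 2) +
        Real.exp (-(r / (2 * ν))) * (∑ k ∈ freq N,
          2 * (conj (fhat (h r) k - fhat (g r) k) * V r k).re) - 1 * (C / N) ≤ 0 := by
    intro r hr
    have hr0 : 0 < r := ha.trans_le (hs.trans hr.1.le)
    have hrI : r ∈ Set.Icc a b := ⟨hs.trans hr.1.le, hr.2.le.trans ht⟩
    have cu := H.contDiff r hr0
    have cv := G.contDiff r hr0
    have cdu := continuous_dx cu
    have cdv := continuous_dx cv
    set u := dx (h r) with hu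
    set v := dx (g r) with hv
    -- Only the monotone cubic part of the flux is paired in physical space; the linear part is left
    -- to `quartic_le`.
    set w : Torus → ℝ := fun x => 2 * (u x ^ 3 - v x ^ 3) with hw
    have hwc : Continuous w := by fun_prop
    have hpars := le_sum_re_conj_fhat_mul (cdu.sub cdv) hwc
      (sum_sq_mul_fhat_dx_sub_le cu cv (hX r hrI) (hY r hrI)) hN
    have hpos : 0 ≤ ∫ x, (u - v) x * w x := by
      refine integral_nonneg fun x => ?_
      have : (u - v) x * w x = (u x - v x) ^ 2 * ((u x + v x) ^ 2 + u x ^ 2 + v x ^ 2) := by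
        simp only [hw, Pi.sub_apply]; ring
      rw [this]
      positivity
    have hwb : 2 * Real.pi * ∫ x, w x ^ 2 ≤ Q := by
      rw [hQ]
      gcongr
      refine integral_sq_le fun x => ?_
      rw [hw, abs_mul, abs_two]
      gcongr
      refine (abs_sub _ _).trans ?_
      rw [abs_pow, abs_pow]
      gcongr
      · exact hA r hrI x
      · exact hB r hrI x
    have hC : (2 * X + 2 * Y + 2 * Real.pi * ∫ x, w x ^ 2) / N ≤ C / N := by
      gcongr
      exact le_trans (by linarith) (le_abs_self _)
    have hlow : -(C / N) ≤ ∑ k ∈ freq N, (conj (fhat (u - v) k) * fhat w k).re := by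
      refine le_trans ?_ hpars
      have : 0 ≤ 2 * Real.pi * ∫ x, (u - v) x * w x := by positivity
      linarith
    have hwhat : ∀ k, fhat w k = 2 * ((fhat (flux (h r)) k - fhat (flux (g r)) k) +
        Complex.I * k * (fhat (h r) k - fhat (g r) k)) := by
      intro k
      have e : w = fun x => 2 * ((flux (h r) - flux (g r)) + (u - v)) x := by
        ext x; simp only [hw, Pi.add_apply, Pi.sub_apply, flux, hu, hv]; ring
      rw [e, fhat_const_mul, fhat_add, fhat_sub, fhat_dx_sub cu cv]
      · push_cast; rfl
      · exact integrable_of_continuous (continuous_flux cu)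
      · exact integrable_of_continuous (continuous_flux cv)
      · exact integrable_of_continuous ((continuous_flux cu).sub (continuous_flux cv))
      · exact integrable_of_continuous (cdu.sub cdv)
    have hterm : ∀ k ∈ freq N, -(1 / (2 * ν)) * ‖fhat (h r) k - fhat (g r) k‖ ^ 2 +
        2 * (conj (fhat (h r) k - fhat (g r) k) * V r k).re ≤
        -(conj (fhat (u - v) k) * fhat w k).re := by
      intro k _
      rw [hwhat, fhat_dx_sub cu cv]
      set d := fhat (h r) k - fhat (g r) k with hd
      set D := fhat (flux (h r)) k - fhat (flux (g r)) k with hD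
      have eV : V r k = ((-ν * (k : ℝ) ^ 4 : ℝ) : ℂ) * d + Complex.I * k * D := by
        simp only [hV, hd, hD]; push_cast; ring
      have e2 : (2 : ℂ) = ((2 : ℝ) : ℂ) := by norm_num
      rw [eV, re_conj_mul_add, re_conj_mul_ofReal, re_conj_mul_I, re_conj_mul_self, e2,
        re_conj_mul_ofReal, re_conj_mul_add, re_conj_mul_self, sq_norm_I_mul]
      have hq := mul_le_mul_of_nonneg_right (quartic_le hν k) (sq_nonneg ‖d‖)
      have : 1 / (2 * ν) = 2 * (1 / (4 * ν)) := by field_simp; ring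
      rw [this]
      linarith
    have hsum := Finset.sum_le_sum hterm
    rw [Finset.sum_add_distrib, ← Finset.mul_sum, Finset.sum_neg_distrib] at hsum
    have he1 : Real.exp (-(r / (2 * ν))) ≤ 1 := by
      rw [Real.exp_le_one_iff, neg_nonpos]
      positivity
    have he0 := Real.exp_pos (-(r / (2 * ν)))
    have hCN : 0 ≤ C / N := by positivity
    have : Real.exp (-(r / (2 * ν))) * (-(1 / (2 * ν)) *
        (∑ k ∈ freq N, ‖fhat (h r) k - fhat (g r) k‖ ^ 2) + (∑ k ∈ freq N,
          2 * (conj (fhat (h r) k - fhat (g r) k) * V r k).re)) ≤ 1 * (C / N) :=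
      le_trans (mul_le_mul_of_nonneg_left (by linarith) he0.le)
        (mul_le_mul_of_nonneg_right he1 hCN)
    linarith
  have hanti := antitoneOn_of_deriv_nonpos (convex_Icc s t)
    (fun r hr => (hd r (ha.trans_le (hs.trans hr.1))).continuousAt.continuousWithinAt)
    (by
      rw [interior_Icc]
      exact fun r hr =>
        (hd r (ha.trans_le (hs.trans hr.1.le))).differentiableAt.differentiableWithinAt)
    (by
      rw [interior_Icc]
      intro r hr
      rw [(hd r (ha.trans_le (hs.trans hr.1.le))).deriv]
      exact hle r hr)
  have := hanti ⟨le_rfl, hst⟩ ⟨hst, le_rfl⟩ hst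
  simp only at this
  linarith

/-! ### Energy and evolution variational inequality -/

/-- The free energy (times `4π`) of the frequencies up to `N`. -/
noncomputable def energy (ν : ℝ) (N : ℕ) (f : Torus → ℝ) : ℝ :=
  ∑ k ∈ freq N, ν * (k : ℝ) ^ 4 * ‖fhat f k‖ ^ 2 +
    2 * Real.pi * ∫ x, (dx f x ^ 2 - 1) ^ 2 / 2

theorem energy_nonneg {ν : ℝ} (hν : 0 ≤ ν) (N : ℕ) (f : Torus → ℝ) : 0 ≤ energy ν N f := by
  unfold energy
  refine add_nonneg (Finset.sum_nonneg fun k _ => by positivity) ?_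
  exact mul_nonneg Real.two_pi_pos.le (integral_nonneg fun x => by positivity)

theorem IsClassical.continuousOn_fhat {ν : ℝ} {h : ℝ → Torus → ℝ} (H : IsClassical ν h) (k : ℤ) :
    ContinuousOn (fun t => fhat (h t) k) (Set.Ioi 0) :=
  fun t ht => (H.ode t ht k).continuousAt.continuousWithinAt

theorem IsClassical.continuousOn_energy {ν : ℝ} {h : ℝ → Torus → ℝ} (H : IsClassical ν h)
    (N : ℕ) : ContinuousOn (fun t => energy ν N (h t)) (Set.Ioi 0) := by
  unfold energy
  refine ContinuousOn.add (continuousOn_finsetSum _ fun k _ => ?_) ?_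
  · exact continuousOn_const.mul ((H.continuousOn_fhat k).norm.pow 2)
  · refine continuousOn_const.mul (continuousOn_integral_torus
      (F := fun t x => (dx (h t) x ^ 2 - 1) ^ 2 / 2) ?_)
    have := H.continuousOn_dx
    fun_prop

/-- Evolution variational inequality, up to high frequencies. -/
theorem IsClassical.exists_sum_sq_sub_le_integral_energy {ν : ℝ} (hν : 0 < ν)
    {h : ℝ → Torus → ℝ} (H : IsClassical ν h) {a : ℝ} (ha : 0 < a) (b : ℝ) :
    ∃ C, 0 ≤ C ∧ ∀ N : ℕ, 0 < N → ∀ s τ, a ≤ s → 0 ≤ τ → s + τ ≤ b →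
      Real.exp (-(τ / (4 * ν))) * ∑ k ∈ freq N, ‖fhat (h (s + τ)) k - fhat (h s) k‖ ^ 2 ≤
      ∫ ρ in (0 : ℝ)..τ, Real.exp (-(ρ / (4 * ν))) *
        (energy ν N (h s) - energy ν N (h (s + ρ)) + C / N) := by
  obtain ⟨X, hX⟩ := H.exists_sum_pow_four_le hν ha b
  obtain ⟨A, hA0, hA⟩ := H.exists_abs_dx_le ha b
  set Q := 2 * Real.pi * ((2 * A ^ 3 + 4 * A) ^ 2 * (2 * Real.pi)) with hQ
  refine ⟨|2 * X + 2 * X + Q|, abs_nonneg _, fun N hN s τ hs hτ hsτ => ?_⟩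
  set C := |2 * X + 2 * X + Q|
  have hN' : (0 : ℝ) < N := by exact_mod_cast hN
  set V : ℝ → ℤ → ℂ := fun r k =>
    -ν * (k : ℝ) ^ 4 * fhat (h r) k + Complex.I * k * fhat (flux (h r)) k with hV
  have hs0 : 0 < s := ha.trans_le hs
  have hd : ∀ ρ, 0 ≤ ρ → HasDerivAt (fun ρ => Real.exp (-(ρ / (4 * ν))) *
      (∑ k ∈ freq N, ‖fhat (h (s + ρ)) k - fhat (h s) k‖ ^ 2))
      (Real.exp (-(ρ / (4 * ν))) * (-(1 / (4 * ν))) *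
        (∑ k ∈ freq N, ‖fhat (h (s + ρ)) k - fhat (h s) k‖ ^ 2) +
        Real.exp (-(ρ / (4 * ν))) * (∑ k ∈ freq N,
          2 * (conj (fhat (h (s + ρ)) k - fhat (h s) k) * V (s + ρ) k).re)) ρ := by
    intro ρ hρ
    refine HasDerivAt.mul (HasDerivAt.exp ?_) (HasDerivAt.fun_sum fun k _ => ?_)
    · exact ((hasDerivAt_id ρ).div_const _).neg
    · exact hasDerivAt_sq_norm
        (((H.ode (s + ρ) (by positivity) k).comp_const_add s ρ).sub_const _)
  have hle : ∀ ρ ∈ Set.Ioo 0 τ, (Real.exp (-(ρ / (4 * ν))) * (-(1 / (4 * ν))) *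
        (∑ k ∈ freq N, ‖fhat (h (s + ρ)) k - fhat (h s) k‖ ^ 2) +
        Real.exp (-(ρ / (4 * ν))) * (∑ k ∈ freq N,
          2 * (conj (fhat (h (s + ρ)) k - fhat (h s) k) * V (s + ρ) k).re)) ≤
        Real.exp (-(ρ / (4 * ν))) *
        (energy ν N (h s) - energy ν N (h (s + ρ)) + C / N) := by
    intro ρ hρ
    set r := s + ρ with hr
    have hsI : s ∈ Set.Icc a b := ⟨hs, by linarith⟩
    have hrI : r ∈ Set.Icc a b := ⟨by linarith [hρ.1], by linarith [hρ.2]⟩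
    have hr0 : 0 < r := ha.trans_le hrI.1
    have cu := H.contDiff r hr0
    have cv := H.contDiff s hs0
    have cdu := continuous_dx cu
    have cdv := continuous_dx cv
    set u := dx (h r) with hu
    set v := dx (h s) with hv
    -- The potential P(u) = (u² - 1)²/2 has P' = 2(u³ - u) and P'' ≥ -2. Hence P(u) - P(v) ≤ (u -
    -- v)(P'(u) + (u - v)), whose second factor is `w`.
    set w : Torus → ℝ := fun x => 2 * (u x ^ 3 - u x) + (u x - v x) with hw
    have hwc : Continuous w := by fun_prop
    have hpars := le_sum_re_conj_fhat_mul (cdu.sub cdv) hwc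
      (sum_sq_mul_fhat_dx_sub_le cu cv (hX r hrI) (hX s hsI)) hN
    have hpot : (∫ x, (u x ^ 2 - 1) ^ 2 / 2) - ∫ x, (v x ^ 2 - 1) ^ 2 / 2 ≤
        ∫ x, (u - v) x * w x := by
      rw [← integral_sub (integrable_of_continuous (by fun_prop))
        (integrable_of_continuous (by fun_prop))]
      refine integral_mono (integrable_of_continuous (by fun_prop))
        (integrable_of_continuous ((cdu.sub cdv).mul hwc)) fun x => ?_
      simp only [hw, Pi.sub_apply]
      nlinarith [mul_nonneg (sq_nonneg (u x - v x))
        (add_nonneg (sq_nonneg (u x + v x)) (mul_nonneg zero_le_two (sq_nonneg (u x))))]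
    have hwb : 2 * Real.pi * ∫ x, w x ^ 2 ≤ Q := by
      rw [hQ]
      gcongr
      refine integral_sq_le fun x => ?_
      have h1 := hA r hrI x
      have h2 := hA s hsI x
      have h3 : |u x ^ 3| ≤ A ^ 3 := by
        rw [abs_pow]; exact pow_le_pow_left₀ (abs_nonneg _) h1 3
      rw [← hu] at h1
      rw [← hv] at h2
      rw [abs_le] at h1 h2 h3 ⊢
      simp only [hw]
      constructor <;> linarith
    have hC : (2 * X + 2 * X + 2 * Real.pi * ∫ x, w x ^ 2) / N ≤ C / N := by
      gcongr
      exact le_trans (by linarith) (le_abs_self _)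
    have hwhat : ∀ k, fhat w k = ((2 : ℝ) : ℂ) * fhat (flux (h r)) k +
        Complex.I * k * (fhat (h r) k - fhat (h s) k) := by
      intro k
      have e : w = (fun x => 2 * flux (h r) x) + (u - v) := by
        ext x; simp only [hw, Pi.add_apply, Pi.sub_apply, flux, hu, hv]; ring
      have cF := continuous_flux cu
      rw [e, fhat_add, fhat_const_mul, fhat_dx_sub cu cv]
      · exact integrable_of_continuous (by fun_prop)
      · exact integrable_of_continuous (cdu.sub cdv)
    have hterm : ∀ k ∈ freq N, -(1 / (4 * ν)) * ‖fhat (h r) k - fhat (h s) k‖ ^ 2 +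
        2 * (conj (fhat (h r) k - fhat (h s) k) * V r k).re ≤
        ν * (k : ℝ) ^ 4 * ‖fhat (h s) k‖ ^ 2 - ν * (k : ℝ) ^ 4 * ‖fhat (h r) k‖ ^ 2
        -(conj (fhat (u - v) k) * fhat w k).re := by
      intro k _
      rw [hwhat, fhat_dx_sub cu cv]
      set d := fhat (h r) k - fhat (h s) k with hd
      have eV : V r k = ((-ν * (k : ℝ) ^ 4 : ℝ) : ℂ) * fhat (h r) k +
          Complex.I * k * fhat (flux (h r)) k := by
        simp only [hV]; push_cast; ring
      -- Polarisation produces the exact difference of the quadratic energies plus ‖d‖², and the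
      -- latter supplies the νk⁴‖d‖² that pays for k²‖d‖².
      have epol : 2 * (conj d * fhat (h r) k).re =
          ‖fhat (h r) k‖ ^ 2 - ‖fhat (h s) k‖ ^ 2 + ‖d‖ ^ 2 := by
        rw [← re_conj_mul_self, ← re_conj_mul_self, ← re_conj_mul_self, hd]
        simp only [map_sub, Complex.mul_re, Complex.sub_re, Complex.sub_im, Complex.conj_re,
          Complex.conj_im]
        ring
      rw [eV, re_conj_mul_add, re_conj_mul_ofReal, re_conj_mul_I, re_conj_mul_add,
        re_conj_mul_ofReal, re_conj_mul_self, sq_norm_I_mul]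
      have hq := mul_le_mul_of_nonneg_right (quartic_le hν k) (sq_nonneg ‖d‖)
      have epol' := congrArg (fun z => ν * (k : ℝ) ^ 4 * z) epol
      linarith
    have hsum := Finset.sum_le_sum hterm
    rw [Finset.sum_add_distrib, ← Finset.mul_sum, Finset.sum_sub_distrib,
      Finset.sum_sub_distrib] at hsum
    have he0 := Real.exp_pos (-(ρ / (4 * ν)))
    rw [mul_assoc, ← mul_add]
    refine mul_le_mul_of_nonneg_left (hsum.trans ?_) he0.le
    have hpi := mul_le_mul_of_nonneg_left hpot Real.two_pi_pos.le
    unfold freq at *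
    unfold energy freq
    linarith
  have hI : IntegrableOn (fun ρ => Real.exp (-(ρ / (4 * ν))) *
        (energy ν N (h s) - energy ν N (h (s + ρ)) + C / N)) (Set.Icc 0 τ) := by
    refine ContinuousOn.integrableOn_compact isCompact_Icc ?_
    refine ContinuousOn.mul (by fun_prop) (ContinuousOn.add (ContinuousOn.sub continuousOn_const ?_)
      continuousOn_const)
    refine (H.continuousOn_energy N).comp (by fun_prop) fun ρ hρ => ?_
    exact add_pos_of_pos_of_nonneg hs0 hρ.1
  have hfin := intervalIntegral.sub_le_integral_of_hasDeriv_right_of_le hτ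
    (fun ρ hρ => (hd ρ hρ.1).continuousAt.continuousWithinAt)
    (fun ρ hρ => (hd ρ hρ.1.le).hasDerivWithinAt) hI hle
  simpa using hfin

/-! ### Decay of the velocity in L² -/

/-- The Fourier coefficients of the right-hand side of the evolution equation. -/
noncomputable def velocity (ν : ℝ) (f : Torus → ℝ) (k : ℤ) : ℂ :=
  -ν * (k : ℝ) ^ 4 * fhat f k + Complex.I * k * fhat (flux f) k

theorem IsClassical.continuousOn_velocity {ν : ℝ} {h : ℝ → Torus → ℝ} (H : IsClassical ν h)
    (k : ℤ) : ContinuousOn (fun t => velocity ν (h t) k) (Set.Ioi 0) := by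
  unfold velocity
  have h1 := H.continuousOn_fhat k
  have h2 := ThinFilm.continuousOn_fhat (F := fun t => flux (h t))
    (continuousOn_flux H.continuousOn_dx) k
  fun_prop

theorem IsClassical.continuousOn_sum_sq_velocity {ν : ℝ} {h : ℝ → Torus → ℝ}
    (H : IsClassical ν h) (N : ℕ) :
    ContinuousOn (fun t => ∑ k ∈ freq N, ‖velocity ν (h t) k‖ ^ 2) (Set.Ioi 0) :=
  continuousOn_finsetSum _ fun k _ => (H.continuousOn_velocity k).norm.pow 2

theorem IsClassical.continuousOn_sum_sq_sub {ν : ℝ} {h : ℝ → Torus → ℝ} (H : IsClassical ν h)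
    (N : ℕ) {τ : ℝ} (hτ : 0 ≤ τ) : ContinuousOn
      (fun s => ∑ k ∈ freq N, ‖fhat (h (s + τ)) k - fhat (h s) k‖ ^ 2) (Set.Ioi 0) :=
  continuousOn_finsetSum _ fun k _ =>
    (((H.shift hτ).continuousOn_fhat k).sub (H.continuousOn_fhat k)).norm.pow 2

theorem intervalIntegrable_of_Ioi {E : Type*} [NormedAddCommGroup E] {f : ℝ → E}
    (hf : ContinuousOn f (Set.Ioi 0)) {a b : ℝ} (ha : 0 < a) (hb : 0 < b) :
    IntervalIntegrable f volume a b :=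
  (hf.mono fun _ hx => lt_of_lt_of_le (lt_min ha hb) hx.1).intervalIntegrable

theorem integral_integral_swap_of_continuousOn {F : ℝ → ℝ → ℝ} {a b c d : ℝ} (hab : a ≤ b)
    (hcd : c ≤ d) (hF : ContinuousOn F.uncurry (Set.Icc a b ×ˢ Set.Icc c d)) :
    ∫ x in a..b, ∫ y in c..d, F x y = ∫ y in c..d, ∫ x in a..b, F x y := by
  refine intervalIntegral_intervalIntegral_swap ?_
  rw [Set.uIoc_of_le hab, Set.uIoc_of_le hcd]
  exact (hF.integrableOn_compact (isCompact_Icc.prod isCompact_Icc)).mono_set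
    (Set.prod_mono Set.Ioc_subset_Icc_self Set.Ioc_subset_Icc_self)

theorem intervalIntegrable_integral_of_continuousOn {F : ℝ → ℝ → ℝ} {a b c d : ℝ} (hab : a ≤ b)
    (hcd : c ≤ d) (hF : ContinuousOn F.uncurry (Set.Icc a b ×ˢ Set.Icc c d)) :
    IntervalIntegrable (fun x => ∫ y in c..d, F x y) volume a b := by
  have h1 : IntegrableOn F.uncurry (Set.Ioc a b ×ˢ Set.Ioc c d) :=
    (hF.integrableOn_compact (isCompact_Icc.prod isCompact_Icc)).mono_set
      (Set.prod_mono Set.Ioc_subset_Icc_self Set.Ioc_subset_Icc_self)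
  rw [IntegrableOn, Measure.volume_eq_prod, ← Measure.prod_restrict] at h1
  rw [intervalIntegrable_iff_integrableOn_Ioc_of_le hab]
  simp only [intervalIntegral.integral_of_le hcd]
  exact h1.integral_prod_left

/-- Uniformity in N comes from the H² bound; the potential part does not involve N and is controlled
by continuity in time. -/
theorem IsClassical.exists_energy_le {ν : ℝ} (hν : 0 < ν) {h : ℝ → Torus → ℝ}
    (H : IsClassical ν h) {a : ℝ} (ha : 0 < a) (b : ℝ) :
    ∃ M, 0 ≤ M ∧ ∀ N, ∀ t ∈ Set.Icc a b, energy ν N (h t) ≤ M := by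
  obtain ⟨X, hX⟩ := H.exists_sum_pow_four_le hν ha b
  obtain ⟨C, hC0, hC⟩ := exists_le_of_continuousOn_Ioi (H.continuousOn_energy 0) ha b
  refine ⟨|ν * X + C|, abs_nonneg _, fun N t ht => le_trans ?_ (le_abs_self _)⟩
  have h1 := mul_le_mul_of_nonneg_left (hX t ht (freq N)) hν.le
  have h2 := hC t ht
  have h3 : 0 ≤ ∑ k ∈ freq 0, ν * (k : ℝ) ^ 4 * ‖fhat (h t) k‖ ^ 2 :=
    Finset.sum_nonneg fun k _ => by positivity
  rw [Finset.mul_sum] at h1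
  simp only [← mul_assoc] at h1
  unfold energy at *
  linarith

/-- The `L²` modulus of continuity in time, averaged over arbitrarily long time intervals. -/
theorem IsClassical.exists_integral_sum_sq_sub_le {ν : ℝ} (hν : 0 < ν) {h : ℝ → Torus → ℝ}
    (H : IsClassical ν h) {a : ℝ} (ha : 0 < a) :
    ∃ M, 0 ≤ M ∧ ∀ b, a ≤ b → ∀ τ, 0 < τ → τ ≤ 1 → ∀ K,
      ∫ s in a..b, ∑ k ∈ freq K, ‖fhat (h (s + τ)) k - fhat (h s) k‖ ^ 2 ≤
        Real.exp (τ / (4 * ν)) * (τ ^ 2 * M) := by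
  obtain ⟨M, hM0, hM⟩ := H.exists_energy_le hν ha (a + 1)
  refine ⟨M, hM0, fun b hab τ hτ hτ1 K => ?_⟩
  obtain ⟨C, hC0, hC⟩ := H.exists_sum_sq_sub_le_integral_energy hν ha (b + 1)
  have hb : 0 < b := ha.trans_le hab
  have hpos : ∀ {s ρ : ℝ}, s ∈ Set.Icc a b → ρ ∈ Set.Icc 0 τ → 0 < s + ρ := fun hs hρ =>
    add_pos_of_pos_of_nonneg (ha.trans_le hs.1) hρ.1
  have key : ∀ N : ℕ, 0 < N → K ≤ N →
      Real.exp (-(τ / (4 * ν))) *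
        ∫ s in a..b, ∑ k ∈ freq K, ‖fhat (h (s + τ)) k - fhat (h s) k‖ ^ 2 ≤
        τ ^ 2 * M + τ * (b - a) * C / N := by
    intro N hN hKN
    have hN' : (0 : ℝ) < N := by exact_mod_cast hN
    set E : ℝ → ℝ := fun t => energy ν N (h t) with hE
    have hEc : ContinuousOn E (Set.Ioi 0) := H.continuousOn_energy N
    set F : ℝ → ℝ → ℝ := fun s ρ => Real.exp (-(ρ / (4 * ν))) * (E s - E (s + ρ) + C / N) with hF
    have hFc : ContinuousOn F.uncurry (Set.Icc a b ×ˢ Set.Icc 0 τ) := by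
      have h1 : ContinuousOn (fun p : ℝ × ℝ => E p.1) (Set.Icc a b ×ˢ Set.Icc 0 τ) :=
        hEc.comp (by fun_prop) fun p hp => ha.trans_le hp.1.1
      have h2 : ContinuousOn (fun p : ℝ × ℝ => E (p.1 + p.2)) (Set.Icc a b ×ˢ Set.Icc 0 τ) :=
        hEc.comp (by fun_prop) fun p hp => hpos hp.1 hp.2
      have h3 : F.uncurry = fun p : ℝ × ℝ =>
        Real.exp (-(p.2 / (4 * ν))) * (E p.1 - E (p.1 + p.2) + C / N) := rfl
      rw [h3]
      exact ContinuousOn.mul (Continuous.continuousOn (by fun_prop))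
        ((h1.sub h2).add continuousOn_const)
    rw [← intervalIntegral.integral_const_mul]
    calc ∫ s in a..b, Real.exp (-(τ / (4 * ν))) *
          ∑ k ∈ freq K, ‖fhat (h (s + τ)) k - fhat (h s) k‖ ^ 2
        ≤ ∫ s in a..b, ∫ ρ in (0 : ℝ)..τ, F s ρ := by
          refine intervalIntegral.integral_mono_on hab
            ((intervalIntegrable_of_Ioi (H.continuousOn_sum_sq_sub K hτ.le) ha hb).const_mul _)
            (intervalIntegrable_integral_of_continuousOn hab hτ.le hFc) fun s hs => ?_
          refine le_trans ?_ (hC N hN s τ hs.1 hτ.le (by linarith [hs.2]))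
          gcongr
          exact freq_mono hKN
      _ = ∫ ρ in (0 : ℝ)..τ, ∫ s in a..b, F s ρ :=
          integral_integral_swap_of_continuousOn hab hτ.le hFc
      _ ≤ ∫ ρ in (0 : ℝ)..τ, (τ * M + (b - a) * (C / N)) := by
          have hFc' : ContinuousOn (Function.uncurry fun ρ s => F s ρ)
              (Set.Icc 0 τ ×ˢ Set.Icc a b) :=
            hFc.comp (f := Prod.swap) (by fun_prop) fun p hp => ⟨hp.2, hp.1⟩
          refine intervalIntegral.integral_mono_on hτ.le
            (intervalIntegrable_integral_of_continuousOn hτ.le hab hFc')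
            intervalIntegrable_const fun ρ hρ => ?_
          have i1 : ∀ {x y : ℝ}, 0 < x → 0 < y → IntervalIntegrable E volume x y :=
            fun hx hy => intervalIntegrable_of_Ioi hEc hx hy
          have haρ : 0 < a + ρ := by linarith [hρ.1]
          have hbρ : 0 < b + ρ := by linarith [hρ.1]
          have i2 : IntervalIntegrable (fun s => E (s + ρ)) volume a b :=
            (intervalIntegrable_of_Ioi ((H.shift hρ.1).continuousOn_energy N) ha hb)
          -- The energy difference telescopes in s: only two end intervals of length ρ remain. The
          -- right one has a favourable sign, so the bound sees the energy near a alone and is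
          -- uniform in b.
          have e1 : ∫ s in a..b, F s ρ = Real.exp (-(ρ / (4 * ν))) *
              ((∫ s in a..a + ρ, E s) - (∫ s in b..b + ρ, E s) + (b - a) * (C / N)) := by
            simp only [hF]
            rw [intervalIntegral.integral_const_mul, intervalIntegral.integral_add
              ((i1 ha hb).sub i2) intervalIntegrable_const, intervalIntegral.integral_sub (i1 ha hb)
              i2, intervalIntegral.integral_comp_add_right (fun s => E s),
              intervalIntegral.integral_interval_sub_interval_comm (i1 ha hb) (i1 haρ hbρ)
              (i1 ha haρ), intervalIntegral.integral_const, smul_eq_mul]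
          have e2 : ∫ s in a..a + ρ, E s ≤ τ * M := by
            calc ∫ s in a..a + ρ, E s ≤ ∫ s in a..a + ρ, M := by
                  refine intervalIntegral.integral_mono_on (by linarith [hρ.1]) (i1 ha haρ)
                    intervalIntegrable_const fun s hs => hM N s ⟨hs.1, ?_⟩
                  linarith [hs.2, hρ.2]
              _ = ρ * M := by simp
              _ ≤ τ * M := by gcongr; exact hρ.2
          have e3 : 0 ≤ ∫ s in b..b + ρ, E s :=
            intervalIntegral.integral_nonneg (by linarith [hρ.1])
              fun s _ => energy_nonneg hν.le N _
          have hexp : Real.exp (-(ρ / (4 * ν))) ≤ 1 := by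
            rw [Real.exp_le_one_iff, neg_nonpos]
            have := hρ.1
            positivity
          rw [e1]
          have hκ : 0 ≤ (b - a) * (C / N) := mul_nonneg (by linarith) (by positivity)
          calc _ ≤ Real.exp (-(ρ / (4 * ν))) * (τ * M + (b - a) * (C / N)) := by
                gcongr; linarith
            _ ≤ 1 * (τ * M + (b - a) * (C / N)) := by gcongr
            _ = _ := one_mul _
      _ = τ ^ 2 * M + τ * (b - a) * C / N := by
          rw [intervalIntegral.integral_const, smul_eq_mul]; ring
  -- The constant `C` depends on b, but its contribution vanishes as N → ∞.
  have hlim : Real.exp (-(τ / (4 * ν))) *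
        ∫ s in a..b, ∑ k ∈ freq K, ‖fhat (h (s + τ)) k - fhat (h s) k‖ ^ 2 ≤ τ ^ 2 * M := by
    have ht : Tendsto (fun N : ℕ => τ ^ 2 * M + τ * (b - a) * C / N) atTop
        (𝓝 (τ ^ 2 * M + 0)) :=
      tendsto_const_nhds.add (tendsto_const_div_atTop_nhds_zero_nat _)
    rw [add_zero] at ht
    refine ge_of_tendsto ht ?_
    filter_upwards [eventually_ge_atTop (K + 1)] with N hN
    exact key N (by omega) (by omega)
  rw [Real.exp_neg, inv_mul_le_iff₀ (Real.exp_pos _)] at hlim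
  exact hlim

theorem IsClassical.tendsto_sum_sq_div {ν : ℝ} {h : ℝ → Torus → ℝ} (H : IsClassical ν h) {t : ℝ}
    (ht : 0 < t) (K : ℕ) :
    Tendsto (fun τ : ℝ => (∑ k ∈ freq K, ‖fhat (h (t + τ)) k - fhat (h t) k‖ ^ 2) / τ ^ 2)
      (𝓝[>] 0) (𝓝 (∑ k ∈ freq K, ‖velocity ν (h t) k‖ ^ 2)) := by
  have h1 : ∀ k ∈ freq K, Tendsto (fun τ : ℝ => ‖τ⁻¹ • (fhat (h (t + τ)) k - fhat (h t) k)‖ ^ 2)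
      (𝓝[>] 0) (𝓝 (‖velocity ν (h t) k‖ ^ 2)) := fun k _ =>
    (((hasDerivAt_iff_tendsto_slope_zero.1 (H.ode t ht k)).mono_left
      (nhdsWithin_mono _ fun x (hx : 0 < x) => hx.ne')).norm.pow 2)
  refine (tendsto_finsetSum _ h1).congr fun τ => ?_
  rw [Finset.sum_div]
  refine Finset.sum_congr rfl fun k _ => ?_
  rw [norm_smul, norm_inv, mul_pow, Real.norm_eq_abs, inv_pow, sq_abs, div_eq_inv_mul]

theorem IsClassical.fhat_sub_eq_integral {ν : ℝ} {h : ℝ → Torus → ℝ} (H : IsClassical ν h) {s τ : ℝ}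
    (hs : 0 < s) (hτ : 0 ≤ τ) (k : ℤ) :
    fhat (h (s + τ)) k - fhat (h s) k = ∫ ρ in (0 : ℝ)..τ, velocity ν (h (s + ρ)) k := by
  have h2 : ∀ ρ ∈ Set.uIcc 0 τ, HasDerivAt (fun ρ => fhat (h (s + ρ)) k)
      (velocity ν (h (s + ρ)) k) ρ := fun ρ hρ => by
    rw [Set.uIcc_of_le hτ] at hρ
    exact (H.ode (s + ρ) (add_pos_of_pos_of_nonneg hs hρ.1) k).comp_const_add s ρ
  have h3 : IntervalIntegrable (fun ρ => velocity ν (h (s + ρ)) k) volume 0 τ := by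
    refine ContinuousOn.intervalIntegrable ?_
    refine (H.continuousOn_velocity k).comp (f := fun ρ => s + ρ) (by fun_prop) fun ρ hρ => ?_
    rw [Set.uIcc_of_le hτ] at hρ
    exact add_pos_of_pos_of_nonneg hs hρ.1
  rw [intervalIntegral.integral_eq_sub_of_hasDerivAt h2 h3, add_zero]

/-- Cauchy–Schwarz, obtained by expanding ∫(τf - I)² ≥ 0. -/
theorem sq_integral_le {f : ℝ → ℝ} {τ : ℝ} (hτ : 0 < τ) (hf : ContinuousOn f (Set.Icc 0 τ)) :
    (∫ ρ in (0 : ℝ)..τ, f ρ) ^ 2 ≤ τ * ∫ ρ in (0 : ℝ)..τ, f ρ ^ 2 := by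
  set I := ∫ ρ in (0 : ℝ)..τ, f ρ with hI
  have c1 : ContinuousOn f (Set.uIcc 0 τ) := by rwa [Set.uIcc_of_le hτ.le]
  have h0 : 0 ≤ ∫ ρ in (0 : ℝ)..τ, (τ * f ρ - I) ^ 2 :=
    intervalIntegral.integral_nonneg hτ.le fun _ _ => sq_nonneg _
  have e : ∀ ρ, (τ * f ρ - I) ^ 2 = τ ^ 2 * f ρ ^ 2 - (2 * τ * I * f ρ - I ^ 2) :=
    fun ρ => by ring
  have i1 : IntervalIntegrable (fun ρ => 2 * τ * I * f ρ) volume 0 τ :=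
    ContinuousOn.intervalIntegrable (by fun_prop)
  simp only [e] at h0
  rw [intervalIntegral.integral_sub (ContinuousOn.intervalIntegrable (by fun_prop))
    (i1.sub intervalIntegrable_const), intervalIntegral.integral_sub i1 intervalIntegrable_const,
    intervalIntegral.integral_const_mul, intervalIntegral.integral_const_mul, ← hI,
    intervalIntegral.integral_const, smul_eq_mul] at h0
  have : 0 ≤ τ * (τ * (∫ ρ in (0 : ℝ)..τ, f ρ ^ 2) - I ^ 2) := by linarith
  linarith [nonneg_of_mul_nonneg_right this hτ]

theorem IsClassical.sum_sq_sub_le_integral {ν : ℝ} {h : ℝ → Torus → ℝ} (H : IsClassical ν h)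
    {s τ : ℝ} (hs : 0 < s) (hτ : 0 < τ) (N : ℕ) :
    ∑ k ∈ freq N, ‖fhat (h (s + τ)) k - fhat (h s) k‖ ^ 2 ≤
      τ * ∫ ρ in (0 : ℝ)..τ, ∑ k ∈ freq N, ‖velocity ν (h (s + ρ)) k‖ ^ 2 := by
  have hc : ∀ k, ContinuousOn (fun ρ => ‖velocity ν (h (s + ρ)) k‖) (Set.Icc 0 τ) := fun k =>
    ((H.continuousOn_velocity k).comp (f := fun ρ => s + ρ) (by fun_prop) fun ρ hρ =>
      add_pos_of_pos_of_nonneg hs hρ.1).norm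
  rw [intervalIntegral.integral_finsetSum, Finset.mul_sum]
  · refine Finset.sum_le_sum fun k _ => ?_
    rw [H.fhat_sub_eq_integral hs hτ.le]
    refine le_trans ?_ (sq_integral_le hτ (hc k))
    gcongr
    exact intervalIntegral.norm_integral_le_integral_norm hτ.le
  · intro k _
    refine ContinuousOn.intervalIntegrable ?_
    rw [Set.uIcc_of_le hτ.le]
    exact (hc k).pow 2

/-- The velocity is square integrable in space and time. -/
theorem IsClassical.exists_integral_sum_sq_velocity_le {ν : ℝ} (hν : 0 < ν) {h : ℝ → Torus → ℝ}
    (H : IsClassical ν h) {a : ℝ} (ha : 0 < a) :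
    ∃ M, ∀ b, a ≤ b → ∀ K, ∫ s in a..b, ∑ k ∈ freq K, ‖velocity ν (h s) k‖ ^ 2 ≤ M := by
  obtain ⟨M, hM0, hM⟩ := H.exists_integral_sum_sq_sub_le hν ha
  refine ⟨M, fun b hab K => ?_⟩
  have hb : 0 < b := ha.trans_le hab
  -- A bound on the velocity up to time b + 1 dominates the difference quotients with τ ≤ 1.
  obtain ⟨C, hC0, hC⟩ := exists_le_of_continuousOn_Ioi (H.continuousOn_sum_sq_velocity K) ha (b + 1)
  have hlim : Tendsto (fun τ : ℝ => ∫ s in a..b,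
      (∑ k ∈ freq K, ‖fhat (h (s + τ)) k - fhat (h s) k‖ ^ 2) / τ ^ 2) (𝓝[>] 0)
      (𝓝 (∫ s in a..b, ∑ k ∈ freq K, ‖velocity ν (h s) k‖ ^ 2)) := by
    refine intervalIntegral.tendsto_integral_filter_of_dominated_convergence (fun _ => C) ?_ ?_
      intervalIntegrable_const ?_
    · filter_upwards [self_mem_nhdsWithin] with τ hτ
      exact ((intervalIntegrable_of_Ioi (H.continuousOn_sum_sq_sub K (le_of_lt hτ)) ha
        hb).div_const _).aestronglyMeasurable_restrict_uIoc
    · filter_upwards [self_mem_nhdsWithin, Ioc_mem_nhdsGT one_pos] with τ hτ hτ1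
      refine Eventually.of_forall fun s hs => ?_
      rw [Set.uIoc_of_le hab] at hs
      have hs0 : 0 < s := ha.trans hs.1
      have hτ0 : 0 < τ := hτ
      rw [Real.norm_eq_abs, abs_of_nonneg (by positivity), div_le_iff₀ (by positivity)]
      refine (H.sum_sq_sub_le_integral hs0 hτ K).trans ?_
      have : ∫ ρ in (0 : ℝ)..τ, ∑ k ∈ freq K, ‖velocity ν (h (s + ρ)) k‖ ^ 2 ≤
          ∫ ρ in (0 : ℝ)..τ, C := by
        refine intervalIntegral.integral_mono_on hτ0.le (ContinuousOn.intervalIntegrable ?_)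
          intervalIntegrable_const fun ρ hρ => ?_
        · refine (H.continuousOn_sum_sq_velocity K).comp (f := fun ρ => s + ρ) (by fun_prop)
            fun ρ hρ => ?_
          rw [Set.uIcc_of_le hτ0.le] at hρ
          exact add_pos_of_pos_of_nonneg hs0 hρ.1
        · exact hC _ ⟨by linarith [hs.1, hρ.1], by linarith [hs.2, hρ.2, hτ1.2]⟩
      calc _ ≤ τ * ∫ ρ in (0 : ℝ)..τ, C := by gcongr
        _ = C * τ ^ 2 := by simp; ring
    · refine Eventually.of_forall fun s hs => ?_
      rw [Set.uIoc_of_le hab] at hs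
      exact H.tendsto_sum_sq_div (ha.trans hs.1) K
  have hlim2 : Tendsto (fun τ : ℝ => Real.exp (τ / (4 * ν)) * M) (𝓝[>] 0) (𝓝 M) := by
    have : Continuous (fun τ : ℝ => Real.exp (τ / (4 * ν)) * M) := by fun_prop
    have := this.tendsto 0
    simp only [zero_div, Real.exp_zero, one_mul] at this
    exact this.mono_left nhdsWithin_le_nhds
  refine le_of_tendsto_of_tendsto hlim hlim2 ?_
  filter_upwards [self_mem_nhdsWithin, Ioc_mem_nhdsGT one_pos] with τ hτ hτ1
  have hτ0 : 0 < τ := hτ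
  rw [intervalIntegral.integral_div, div_le_iff₀ (by positivity)]
  refine (hM b hab τ hτ hτ1.2 K).trans (le_of_eq ?_)
  ring

theorem IsClassical.eventually_integral_sum_sq_velocity_le {ν : ℝ} (hν : 0 < ν)
    {h : ℝ → Torus → ℝ} (H : IsClassical ν h) {ε : ℝ} (hε : 0 < ε) :
    ∀ᶠ t in atTop, ∀ N, ∫ s in t - 1..t + 1, ∑ k ∈ freq N, ‖velocity ν (h s) k‖ ^ 2 ≤ ε := by
  obtain ⟨M, hM⟩ := H.exists_integral_sum_sq_velocity_le hν one_pos
  set q : ℕ → ℝ → ℝ := fun N s => ∑ k ∈ freq N, ‖velocity ν (h s) k‖ ^ 2 with hq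
  have hqc : ∀ N {x y : ℝ}, 0 < x → 0 < y → IntervalIntegrable (q N) volume x y :=
    fun N {x y} hx hy => intervalIntegrable_of_Ioi (H.continuousOn_sum_sq_velocity N) hx hy
  have hq0 : ∀ N s, 0 ≤ q N s := fun N s => Finset.sum_nonneg fun k _ => by positivity
  have hqm : ∀ {K N : ℕ}, K ≤ N → ∀ s, q K s ≤ q N s := fun hKN s =>
    Finset.sum_le_sum_of_subset_of_nonneg (freq_mono hKN) fun _ _ _ => by positivity
  -- The supremum over both the cutoff and the final time makes the tail estimate uniform in N: past
  -- a nearly optimal x₀, no window can contribute more than ε for any cutoff.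
  set A : Set ℝ := {y | ∃ N : ℕ, ∃ x, 1 ≤ x ∧ y = ∫ s in (1 : ℝ)..x, q N s} with hA
  have hbdd : BddAbove A := by
    refine ⟨M, ?_⟩
    rintro y ⟨N, x, hx, rfl⟩
    exact hM x hx N
  have hne : A.Nonempty := ⟨_, 0, 1, le_rfl, rfl⟩
  obtain ⟨y, ⟨N₀, x₀, hx₀, rfl⟩, hy⟩ := exists_lt_of_lt_csSup hne (sub_lt_self (sSup A) hε)
  filter_upwards [eventually_ge_atTop (x₀ + 1)] with t ht N
  have hmono : ∫ s in t - 1..t + 1, q N s ≤ ∫ s in t - 1..t + 1, q (max N N₀) s :=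
    intervalIntegral.integral_mono_on (by linarith) (hqc N (by linarith) (by linarith))
      (hqc _ (by linarith) (by linarith)) fun s _ => hqm (le_max_left _ _) s
  refine hmono.trans ?_
  have h1 : ∫ s in (1 : ℝ)..t + 1, q (max N N₀) s ≤ sSup A :=
    le_csSup hbdd ⟨max N N₀, t + 1, by linarith, rfl⟩
  have h2 : ∫ s in (1 : ℝ)..x₀, q N₀ s ≤ ∫ s in (1 : ℝ)..x₀, q (max N N₀) s :=
    intervalIntegral.integral_mono_on hx₀ (hqc N₀ one_pos (by linarith))
      (hqc _ one_pos (by linarith)) fun s _ => hqm (le_max_right _ _) s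
  have h3 := intervalIntegral.integral_add_adjacent_intervals
    (hqc (max N N₀) one_pos (by linarith : 0 < x₀))
    (hqc (max N N₀) (by linarith : 0 < x₀) (by linarith : 0 < t - 1))
  have h4 := intervalIntegral.integral_add_adjacent_intervals
    (hqc (max N N₀) one_pos (by linarith : 0 < t - 1))
    (hqc (max N N₀) (by linarith : 0 < t - 1) (by linarith : 0 < t + 1))
  have h5 : 0 ≤ ∫ s in x₀..t - 1, q (max N N₀) s :=
    intervalIntegral.integral_nonneg (by linarith) fun s _ => hq0 _ s
  linarith

/-- The velocity is the limit of (h(t+τ) - h(t))/τ, a difference of two solutions. By L² stability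
its norm at t is at most e^{1/(2ν)} times its norm at any time in [t-1, t]; averaging over that
window gives the integral. -/
theorem IsClassical.sum_sq_velocity_le {ν : ℝ} (hν : 0 < ν) {h : ℝ → Torus → ℝ}
    (H : IsClassical ν h) {t : ℝ} (ht : 1 < t) {ε : ℝ}
    (hε : ∀ N, ∫ s in t - 1..t + 1, ∑ k ∈ freq N, ‖velocity ν (h s) k‖ ^ 2 ≤ ε) (K : ℕ) :
    ∑ k ∈ freq K, ‖velocity ν (h t) k‖ ^ 2 ≤ Real.exp (1 / (2 * ν)) * ε := by
  have ha : 0 < t - 1 := by linarith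
  refine le_of_tendsto (H.tendsto_sum_sq_div (by linarith) K) ?_
  filter_upwards [self_mem_nhdsWithin, Ioc_mem_nhdsGT one_pos] with τ hτ hτ1
  have hτ0 : 0 < τ := hτ
  rw [div_le_iff₀ (by positivity)]
  obtain ⟨C, hC0, hC⟩ := (H.shift hτ0.le).exists_sum_sq_sub_le hν H ha t
  have key : ∀ N : ℕ, 0 < N → K ≤ N → ∑ k ∈ freq K, ‖fhat (h (t + τ)) k - fhat (h t) k‖ ^ 2 ≤
      Real.exp (1 / (2 * ν)) * ε * τ ^ 2 + Real.exp (t / (2 * ν)) * C / N := by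
    intro N hN hKN
    have hN' : (0 : ℝ) < N := by exact_mod_cast hN
    set n : ℝ → ℝ := fun s => ∑ k ∈ freq N, ‖fhat (h (s + τ)) k - fhat (h s) k‖ ^ 2 with hn
    set q : ℝ → ℝ := fun s => ∑ k ∈ freq N, ‖velocity ν (h s) k‖ ^ 2 with hq
    have hqc := H.continuousOn_sum_sq_velocity N
    have hn0 : ∀ s, 0 ≤ n s := fun s => Finset.sum_nonneg fun k _ => by positivity
    have hni : IntervalIntegrable n volume (t - 1) t :=
      intervalIntegrable_of_Ioi (H.continuousOn_sum_sq_sub N hτ0.le) ha (by linarith)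
    have hstep : ∀ s ∈ Set.Icc (t - 1) t,
        n t ≤ Real.exp (1 / (2 * ν)) * n s + Real.exp (t / (2 * ν)) * C / N := by
      intro s hs
      have h1 := hC N hN s t hs.1 hs.2 le_rfl
      have h2 := mul_le_mul_of_nonneg_left h1 (Real.exp_pos (t / (2 * ν))).le
      rw [← mul_assoc, ← Real.exp_add, add_neg_cancel, Real.exp_zero, one_mul, mul_add,
        ← mul_assoc, ← Real.exp_add] at h2
      refine h2.trans (add_le_add ?_ ?_)
      · refine mul_le_mul_of_nonneg_right (Real.exp_le_exp.2 ?_) (hn0 s)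
        rw [← sub_eq_add_neg, ← sub_div]
        gcongr
        linarith [hs.1]
      · rw [mul_div_assoc]
        refine mul_le_mul_of_nonneg_left ?_ (Real.exp_pos _).le
        have : 0 ≤ C / N := by positivity
        nlinarith [hs.1]
    have hint : n t ≤ Real.exp (1 / (2 * ν)) * (∫ s in t - 1..t, n s) +
        Real.exp (t / (2 * ν)) * C / N := by
      have h1 := intervalIntegral.integral_mono_on (by linarith : t - 1 ≤ t)
        (intervalIntegrable_const (c := n t) (μ := volume))
        ((hni.const_mul (Real.exp (1 / (2 * ν)))).add
          (intervalIntegrable_const (c := Real.exp (t / (2 * ν)) * C / N))) hstep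
      rw [intervalIntegral.integral_add (hni.const_mul _) intervalIntegrable_const,
        intervalIntegral.integral_const_mul] at h1
      simpa using h1
    have hFc : ContinuousOn (Function.uncurry fun s ρ => q (s + ρ))
        (Set.Icc (t - 1) t ×ˢ Set.Icc 0 τ) :=
      hqc.comp (f := fun p : ℝ × ℝ => p.1 + p.2) (by fun_prop) fun p hp =>
        add_pos_of_pos_of_nonneg (ha.trans_le hp.1.1) hp.2.1
    have hFc' : ContinuousOn (Function.uncurry fun ρ s => q (s + ρ))
        (Set.Icc 0 τ ×ˢ Set.Icc (t - 1) t) :=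
      hFc.comp (f := Prod.swap) (by fun_prop) fun p hp => ⟨hp.2, hp.1⟩
    have hn_le : ∫ s in t - 1..t, n s ≤ τ ^ 2 * ε := by
      calc ∫ s in t - 1..t, n s ≤ ∫ s in t - 1..t, τ * ∫ ρ in (0 : ℝ)..τ, q (s + ρ) :=
            intervalIntegral.integral_mono_on (by linarith) hni
              ((intervalIntegrable_integral_of_continuousOn (by linarith) hτ0.le hFc).const_mul _)
              fun s hs => H.sum_sq_sub_le_integral (ha.trans_le hs.1) hτ0 N
        _ = τ * ∫ ρ in (0 : ℝ)..τ, ∫ s in t - 1..t, q (s + ρ) := by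
            rw [intervalIntegral.integral_const_mul,
              integral_integral_swap_of_continuousOn (by linarith) hτ0.le hFc]
        _ ≤ τ * ∫ ρ in (0 : ℝ)..τ, ε := by
            refine mul_le_mul_of_nonneg_left ?_ hτ0.le
            refine intervalIntegral.integral_mono_on hτ0.le
              (intervalIntegrable_integral_of_continuousOn hτ0.le (by linarith) hFc')
              intervalIntegrable_const fun ρ hρ => ?_
            rw [intervalIntegral.integral_comp_add_right (fun s => q s)]
            refine le_trans ?_ (hε N)
            refine intervalIntegral.integral_mono_interval (by linarith [hρ.1]) (by linarith)
              (by linarith [hρ.2, hτ1.2]) ?_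
              (intervalIntegrable_of_Ioi hqc ha (by linarith))
            exact Eventually.of_forall fun s => Finset.sum_nonneg fun k _ => by positivity
        _ = τ ^ 2 * ε := by simp; ring
    calc _ ≤ n t := Finset.sum_le_sum_of_subset_of_nonneg (freq_mono hKN)
          fun _ _ _ => by positivity
      _ ≤ _ := hint
      _ ≤ Real.exp (1 / (2 * ν)) * (τ ^ 2 * ε) + Real.exp (t / (2 * ν)) * C / N := by gcongr
      _ = _ := by ring
  have hlim : Tendsto (fun N : ℕ => Real.exp (1 / (2 * ν)) * ε * τ ^ 2 +
      Real.exp (t / (2 * ν)) * C / N) atTop (𝓝 (Real.exp (1 / (2 * ν)) * ε * τ ^ 2 + 0)) :=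
    tendsto_const_nhds.add (tendsto_const_div_atTop_nhds_zero_nat _)
  rw [add_zero] at hlim
  refine ge_of_tendsto hlim ?_
  filter_upwards [eventually_ge_atTop (K + 1)] with N hN
  exact key N (by omega) (by omega)

/-- The velocity tends to zero in `L²`. -/
theorem IsClassical.eventually_sum_sq_velocity_le {ν : ℝ} (hν : 0 < ν) {h : ℝ → Torus → ℝ}
    (H : IsClassical ν h) {ε : ℝ} (hε : 0 < ε) :
    ∀ᶠ t in atTop, ∀ K, ∑ k ∈ freq K, ‖velocity ν (h t) k‖ ^ 2 ≤ ε := by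
  have h0 := Real.exp_pos (1 / (2 * ν))
  filter_upwards [H.eventually_integral_sum_sq_velocity_le hν (div_pos hε h0),
    eventually_gt_atTop 1] with t ht ht1 K
  have := H.sum_sq_velocity_le hν ht1 ht K
  rwa [mul_div_cancel₀ _ h0.ne'] at this

/-! ### Primitives and second differences -/

theorem integral_torus_const (c : ℝ) : ∫ _ : Torus, c = 2 * Real.pi * c := by
  rw [integral_const, Measure.real, AddCircle.measure_univ,
    ENNReal.toReal_ofReal Real.two_pi_pos.le, smul_eq_mul]

/-- A continuous function of mean zero on the torus has a primitive of mean zero. -/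
theorem exists_primitive {φ : Torus → ℝ} (hφ : Continuous φ) (h0 : ∫ x, φ x = 0) :
    ∃ V : Torus → ℝ, Continuous V ∧ ∫ x, V x = 0 ∧
      ∀ y : ℝ, HasDerivAt (fun z : ℝ => V (z : Torus)) (φ (y : Torus)) y := by
  have hφc : Continuous (fun y : ℝ => φ (y : Torus)) := hφ.comp (AddCircle.continuous_mk' _)
  set P : ℝ → ℝ := fun y => ∫ z in (0 : ℝ)..y, φ (z : Torus) with hP
  have hPd : ∀ y : ℝ, HasDerivAt P (φ (y : Torus)) y := fun y => hφc.integral_hasStrictDerivAt 0 y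
    |>.hasDerivAt
  have hper : Function.Periodic P (2 * Real.pi) := by
    intro y
    have h1 := intervalIntegral.integral_add_adjacent_intervals
      (hφc.intervalIntegrable (μ := volume) 0 y) (hφc.intervalIntegrable y (y + 2 * Real.pi))
    rw [AddCircle.intervalIntegral_preimage (2 * Real.pi) y φ, h0, add_zero] at h1
    exact h1.symm
  set c := (∫ x : Torus, hper.lift x) / (2 * Real.pi) with hc
  have hLc : Continuous (hper.lift : Torus → ℝ) :=
    isQuotientMap_coe.continuous_iff.2
      (continuous_iff_continuousAt.2 fun y => (hPd y).continuousAt)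
  refine ⟨fun x => hper.lift x - c, by fun_prop, ?_, fun y => ?_⟩
  · rw [integral_sub (integrable_of_continuous hLc) (integrable_of_continuous continuous_const),
      integral_torus_const, hc, mul_div_cancel₀ _ Real.two_pi_pos.ne', sub_self]
  · exact (hPd y).sub_const c

/-- A function with second derivative at least `κ` near a point has second differences at least
`κ y²` there. -/
theorem exists_second_difference_ge {W V φ : ℝ → ℝ} (hW : ∀ y, HasDerivAt W (V y) y)
    (hV : ∀ y, HasDerivAt V (φ y) y) (hφ : Continuous φ) {x κ : ℝ} (hκ : κ < φ x) :
    ∃ y, 0 < y ∧ κ * y ^ 2 ≤ W (x + y) + W (x - y) - 2 * W x := by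
  obtain ⟨η, hη, hball⟩ := Metric.eventually_nhds_iff.1
    (hφ.continuousAt.eventually (lt_mem_nhds hκ))
  have hmem : ∀ z ∈ Set.Icc (x - η / 2) (x + η / 2), κ < φ z := fun z hz =>
    hball (by rw [Real.dist_eq, abs_lt]; constructor <;> linarith [hz.1, hz.2])
  -- Subtracting κz²/2 leaves a convex function near x, and midpoint convexity is the claim.
  have hg : ∀ z, HasDerivAt (fun z => W z - κ / 2 * z ^ 2) (V z - κ * z) z := fun z => by
    refine ((hW z).sub ((hasDerivAt_pow 2 z).const_mul (κ / 2))).congr_deriv ?_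
    simp; ring
  have hg' : ∀ z, HasDerivAt (fun z => V z - κ * z) (φ z - κ) z := fun z => by
    refine ((hV z).sub ((hasDerivAt_id z).const_mul κ)).congr_deriv ?_
    rw [mul_one]
  have hconv : ConvexOn ℝ (Set.Icc (x - η / 2) (x + η / 2)) (fun z => W z - κ / 2 * z ^ 2) := by
    refine MonotoneOn.convexOn_of_deriv (convex_Icc _ _)
      (fun z _ => (hg z).continuousAt.continuousWithinAt)
      (fun z _ => (hg z).differentiableAt.differentiableWithinAt) ?_
    have e : deriv (fun z => W z - κ / 2 * z ^ 2) = fun z => V z - κ * z :=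
      funext fun z => (hg z).deriv
    rw [e]
    refine (monotoneOn_of_deriv_nonneg (convex_Icc _ _)
      (fun z _ => (hg' z).continuousAt.continuousWithinAt)
      (fun z _ => (hg' z).differentiableAt.differentiableWithinAt) fun z hz => ?_).mono
      interior_subset
    rw [(hg' z).deriv]
    linarith [hmem z (interior_subset hz)]
  refine ⟨η / 2, half_pos hη, ?_⟩
  have h := hconv.2 (Set.right_mem_Icc.2 (by linarith)) (Set.left_mem_Icc.2 (by linarith))
    (by norm_num : (0 : ℝ) ≤ 1 / 2) (by norm_num : (0 : ℝ) ≤ 1 / 2) (by norm_num)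
  simp only [smul_eq_mul] at h
  have e : 1 / 2 * (x + η / 2) + 1 / 2 * (x - η / 2) = x := by ring
  rw [e] at h
  nlinarith

/-- The second difference multiplies the character by 2cos(ky) - 2, and 1 - cos θ ≤ θ²/2. -/
theorem norm_fourier_second_difference_le (k : ℤ) (x y : ℝ) :
    ‖(fourier k ((x + y : ℝ) : Torus) + fourier k ((x - y : ℝ) : Torus) -
      2 * fourier k (x : Torus) : ℂ)‖ ≤ (k : ℝ) ^ 2 * y ^ 2 := by
  have e : (fourier k ((x + y : ℝ) : Torus) + fourier k ((x - y : ℝ) : Torus) -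
      2 * fourier k (x : Torus) : ℂ) =
      fourier k (x : Torus) * ((2 * Real.cos (k * y) - 2 : ℝ) : ℂ) := by
    have hpi : (Real.pi : ℂ) ≠ 0 := by exact_mod_cast Real.pi_ne_zero
    have hexp : ∀ z : ℝ, (fourier k (z : Torus) : ℂ) = Complex.exp (k * z * Complex.I) := by
      intro z
      rw [fourier_coe_apply]
      congr 1
      push_cast
      field_simp
    rw [hexp, hexp, hexp]
    push_cast
    have e1 : Complex.exp (k * (x + y) * Complex.I) =
        Complex.exp (k * x * Complex.I) * Complex.exp (k * y * Complex.I) := by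
      rw [← Complex.exp_add]; ring_nf
    have e2 : Complex.exp (k * (x - y) * Complex.I) =
        Complex.exp (k * x * Complex.I) * Complex.exp (-(k * y) * Complex.I) := by
      rw [← Complex.exp_add]; ring_nf
    rw [Complex.two_cos, e1, e2]
    ring
  rw [e, norm_mul, fourier_apply, Circle.norm_coe, one_mul, Complex.norm_real, Real.norm_eq_abs,
    abs_le]
  have h1 := Real.one_sub_sq_div_two_le_cos (x := k * y)
  have h2 := Real.cos_le_one (k * y)
  have h3 : 0 ≤ (k : ℝ) ^ 2 * y ^ 2 := by positivity
  constructor <;> nlinarith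

theorem abs_second_difference_le {Z : Torus → ℝ} (hZ : Continuous Z) {C : ℝ}
    (hs : Summable fun k : ℤ => ‖fhat Z k‖)
    (hC : ∀ S : Finset ℤ, ∑ k ∈ S, (k : ℝ) ^ 2 * ‖fhat Z k‖ ≤ C) (x y : ℝ) :
    |Z ((x + y : ℝ) : Torus) + Z ((x - y : ℝ) : Torus) - 2 * Z (x : Torus)| ≤
      C / (2 * Real.pi) * y ^ 2 := by
  have hpi := Real.two_pi_pos
  let F : C(Torus, ℂ) := ⟨fun x => (Z x : ℂ), by fun_prop⟩
  have hcoef : ∀ k, fourierCoeff F k = ((2 * Real.pi : ℝ)⁻¹ : ℂ) * fhat Z k := by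
    intro k
    rw [fhat_eq, ← mul_assoc, inv_mul_cancel₀ (by exact_mod_cast hpi.ne'), one_mul]
    rfl
  have hsum : Summable (fourierCoeff F) := by
    have : fourierCoeff F = fun k => ((2 * Real.pi : ℝ)⁻¹ : ℂ) * fhat Z k := funext hcoef
    rw [this]
    exact (Summable.of_norm hs).mul_left _
  have h := fun z : ℝ => has_pointwise_sum_fourier_series_of_summable hsum (z : Torus)
  have hd := ((h (x + y)).add (h (x - y))).sub ((h x).mul_left 2)
  have hF : ((Z ((x + y : ℝ) : Torus) + Z ((x - y : ℝ) : Torus) - 2 * Z (x : Torus) : ℝ) : ℂ) =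
      F ((x + y : ℝ) : Torus) + F ((x - y : ℝ) : Torus) - 2 * F (x : Torus) := by
    simp [F]
  rw [← Real.norm_eq_abs, ← Complex.norm_real, hF]
  refine le_of_tendsto hd.norm (Eventually.of_forall fun S => ?_)
  refine (norm_sum_le _ _).trans ?_
  calc _ ≤ ∑ k ∈ S, (2 * Real.pi)⁻¹ * y ^ 2 * ((k : ℝ) ^ 2 * ‖fhat Z k‖) := by
        refine Finset.sum_le_sum fun k _ => ?_
        have e : fourierCoeff F k • fourier k ((x + y : ℝ) : Torus) +
            fourierCoeff F k • fourier k ((x - y : ℝ) : Torus) -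
            2 * fourierCoeff F k • fourier k (x : Torus) = fourierCoeff F k *
            (fourier k ((x + y : ℝ) : Torus) + fourier k ((x - y : ℝ) : Torus) -
            2 * fourier k (x : Torus) : ℂ) := by
          simp only [smul_eq_mul]; ring
        rw [e, norm_mul, hcoef, norm_mul]
        have hn : ‖((2 * Real.pi : ℝ)⁻¹ : ℂ)‖ = (2 * Real.pi)⁻¹ := by
          rw [norm_inv, Complex.norm_real, Real.norm_eq_abs, abs_of_pos hpi]
        rw [hn]
        calc _ ≤ (2 * Real.pi)⁻¹ * ‖fhat Z k‖ * ((k : ℝ) ^ 2 * y ^ 2) := by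
              gcongr
              exact norm_fourier_second_difference_le k x y
          _ = _ := by ring
    _ = (2 * Real.pi)⁻¹ * y ^ 2 * ∑ k ∈ S, (k : ℝ) ^ 2 * ‖fhat Z k‖ := by rw [Finset.mul_sum]
    _ ≤ (2 * Real.pi)⁻¹ * y ^ 2 * C := by gcongr; exact hC S
    _ = _ := by ring

/-! ### Maximum principle for the slope -/

theorem sum_le_of_sum_freq_le {f : ℤ → ℝ} (hf : ∀ k, 0 ≤ f k) {C : ℝ}
    (h : ∀ K, ∑ k ∈ freq K, f k ≤ C) (S : Finset ℤ) : ∑ k ∈ S, f k ≤ C := by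
  refine le_trans (Finset.sum_le_sum_of_subset_of_nonneg (t := freq (S.sup Int.natAbs)) ?_
    fun k _ _ => hf k) (h _)
  intro k hk
  have := Finset.le_sup (f := Int.natAbs) hk
  unfold freq
  rw [Finset.mem_Icc]
  omega

/-- The divergence form ∂ₜh = ∂ₓ(flux - ν∂ₓ²u), on which the maximum principle rests. -/
theorem velocity_eq {f : Torus → ℝ} (hf : ContDiff ℝ 1 (fun y : ℝ => f (y : Torus))) (ν : ℝ)
    (k : ℤ) : velocity ν f k =
      Complex.I * k * (fhat (flux f) k + ν * (k : ℝ) ^ 2 * fhat (dx f) k) := by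
  rw [fhat_dx hf, velocity]
  push_cast
  linear_combination (-(ν : ℂ) * k ^ 4 * fhat f k) * Complex.I_sq

/-- The mean of the flux. -/
noncomputable def meanFlux (f : Torus → ℝ) : ℝ := (∫ x, flux f x) / (2 * Real.pi)

/-- The error constant in the maximum principle. -/
noncomputable def errorConst : ℝ := (1 + ∑' k : ℤ, 1 / (k : ℝ) ^ 2) / (4 * Real.pi)

theorem errorConst_pos : 0 < errorConst := by
  have : 0 ≤ ∑' k : ℤ, 1 / (k : ℝ) ^ 2 := tsum_nonneg fun k => by positivity
  unfold errorConst
  have := Real.pi_pos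
  positivity

/-- Maximum principle: where the slope is maximal, the flux is almost at most its mean. -/
theorem flux_le_of_isMax {ν : ℝ} (hν : 0 < ν) {f : Torus → ℝ}
    (hf : ContDiff ℝ 1 (fun y : ℝ => f (y : Torus))) {δ : ℝ} (hδ : 0 < δ)
    (hv : ∀ K, ∑ k ∈ freq K, ‖velocity ν f k‖ ^ 2 ≤ δ ^ 2) {x : Torus}
    (hx : ∀ y, dx f y ≤ dx f x) : flux f x ≤ meanFlux f + errorConst * δ := by
  have hpi := Real.two_pi_pos
  have hv' := sum_le_of_sum_freq_le (fun k => by positivity) hv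
  have hsq : Summable fun k : ℤ => 1 / (k : ℝ) ^ 2 := Real.summable_one_div_int_pow.2 (by norm_num)
  set u := dx f with hu
  have huc : Continuous u := continuous_dx hf
  have hFc := continuous_flux hf
  set φ : Torus → ℝ := flux f - fun _ => meanFlux f with hφ
  have hφc : Continuous φ := hFc.sub continuous_const
  have hφ0 : ∫ y, φ y = 0 := by
    simp only [hφ, Pi.sub_apply]
    rw [integral_sub (integrable_of_continuous hFc) (integrable_of_continuous continuous_const),
      integral_torus_const, meanFlux, mul_div_cancel₀ _ hpi.ne', sub_self]
  obtain ⟨V, hVc, hV0, hVd⟩ := exists_primitive hφc hφ0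
  obtain ⟨W, hWc, -, hWd⟩ := exists_primitive hVc hV0
  have hφhat : ∀ k : ℤ, k ≠ 0 → fhat (flux f) k = -(k : ℂ) ^ 2 * fhat W k := by
    intro k hk
    have h1 := fhat_of_hasDerivAt hφc hVd k
    rw [fhat_of_hasDerivAt hVc hWd, hφ, fhat_sub (integrable_of_continuous hFc)
      (integrable_of_continuous continuous_const)] at h1
    have h2 : fhat (fun _ => meanFlux f) k = 0 := by
      have h3 := fhat_of_hasDerivAt (f := fun _ => meanFlux f) (g := fun _ => 0) continuous_const
        (fun y => hasDerivAt_const y _) k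
      have h4 : fhat (fun _ => 0) k = 0 := by simp [fhat]
      rw [h4] at h3
      have : Complex.I * (k : ℂ) ≠ 0 := mul_ne_zero Complex.I_ne_zero (by exact_mod_cast hk)
      exact (mul_eq_zero.1 h3.symm).resolve_left this
    rw [h2, sub_zero] at h1
    linear_combination h1 + ((k : ℂ) ^ 2 * fhat W k) * Complex.I_sq
  -- Formally -Z'' is flux - mean - νu'', a primitive of the velocity. Using Z with second
  -- differences avoids differentiating u twice.
  set Z : Torus → ℝ := (fun y => ν * u y) - W with hZ
  have hZc : Continuous Z := by fun_prop
  have hZhat : ∀ k : ℤ, k ≠ 0 → (k : ℝ) ^ 2 * ‖fhat Z k‖ = ‖velocity ν f k‖ / |(k : ℝ)| := by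
    intro k hk
    have h1 : fhat Z k = ν * fhat u k - fhat W k := by
      rw [hZ, fhat_sub (integrable_of_continuous (by fun_prop)) (integrable_of_continuous hWc),
        fhat_const_mul]
    have h2 : velocity ν f k = Complex.I * k * ((k : ℂ) ^ 2 * fhat Z k) := by
      rw [velocity_eq hf, hφhat k hk, h1]
      push_cast
      ring
    have hk' : |(k : ℝ)| ≠ 0 := abs_ne_zero.2 (by exact_mod_cast hk)
    rw [h2, norm_mul, norm_mul, norm_mul, Complex.norm_I, norm_pow, Complex.norm_intCast, sq_abs]
    field_simp
  -- Young's inequality with weight δ for ‖v̂‖/|k|. At k = 0 the left side vanishes and 1/0 = 0.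
  have hbound : ∀ k : ℤ, (k : ℝ) ^ 2 * ‖fhat Z k‖ ≤
      1 / (2 * δ) * ‖velocity ν f k‖ ^ 2 + δ / 2 * (1 / (k : ℝ) ^ 2) := by
    intro k
    by_cases hk : k = 0
    · subst hk
      simp only [Int.cast_zero]
      have : 0 ≤ 1 / (2 * δ) * ‖velocity ν f 0‖ ^ 2 := by positivity
      simpa using this
    · rw [hZhat k hk]
      have hk' : 0 < |(k : ℝ)| := abs_pos.2 (by exact_mod_cast hk)
      rw [← sq_abs (k : ℝ), ← sub_nonneg]
      have : 1 / (2 * δ) * ‖velocity ν f k‖ ^ 2 + δ / 2 * (1 / |(k : ℝ)| ^ 2) -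
          ‖velocity ν f k‖ / |(k : ℝ)| =
          (‖velocity ν f k‖ * |(k : ℝ)| - δ) ^ 2 / (2 * δ * |(k : ℝ)| ^ 2) := by
        field_simp
        ring
      rw [this]
      positivity
  have hC : ∀ S : Finset ℤ, ∑ k ∈ S, (k : ℝ) ^ 2 * ‖fhat Z k‖ ≤
      δ / 2 * (1 + ∑' k : ℤ, 1 / (k : ℝ) ^ 2) := by
    intro S
    refine (Finset.sum_le_sum fun k _ => hbound k).trans ?_
    rw [Finset.sum_add_distrib, ← Finset.mul_sum, ← Finset.mul_sum, mul_add]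
    refine add_le_add ?_ ?_
    · calc _ ≤ 1 / (2 * δ) * δ ^ 2 := by gcongr; exact hv' S
        _ = _ := by field_simp
    · gcongr
      exact hsq.sum_le_tsum S fun k _ => by positivity
  have hsum : Summable fun k : ℤ => ‖fhat Z k‖ := by
    have h1 : Summable fun k : ℤ => (k : ℝ) ^ 2 * ‖fhat Z k‖ :=
      summable_of_sum_le (fun k => by positivity) hC
    refine (h1.add (summable_of_ne_finset_zero (s := {0})
      (f := fun k : ℤ => if k = 0 then ‖fhat Z 0‖ else 0) ?_)).of_nonneg_of_le
      (fun k => norm_nonneg _) ?_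
    · intro k hk
      simp only [Finset.mem_singleton] at hk
      simp [hk]
    · intro k
      by_cases hk : k = 0
      · subst hk; simp
      · have : (1 : ℝ) ≤ (k : ℝ) ^ 2 := by
          have : 0 < k ^ 2 := by positivity
          exact_mod_cast this
        simp only [hk, if_false, add_zero]
        exact le_mul_of_one_le_left (norm_nonneg _) this
  obtain ⟨y₀, rfl⟩ := QuotientAddGroup.mk_surjective x
  by_contra! hlt
  have hlt' : errorConst * δ < φ (y₀ : Torus) := by
    simp only [hφ, Pi.sub_apply]
    exact lt_sub_iff_add_lt'.2 hlt
  obtain ⟨κ, hκ1, hκ2⟩ := exists_between hlt'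
  -- If the flux exceeded the bound, W would have second difference at least κy² while that of u is
  -- nonpositive at its maximum. Then Z = νu - W would have second difference at most -κy²,
  -- contradicting the bound for Z.
  obtain ⟨y, hy, hWy⟩ := exists_second_difference_ge hWd hVd
    (hφc.comp (AddCircle.continuous_mk' _)) hκ2
  have hZy := (abs_le.1 (abs_second_difference_le hZc hsum hC y₀ y)).1
  have hZe : ∀ z, Z z = ν * u z - W z := fun z => rfl
  rw [hZe, hZe, hZe] at hZy
  have hu1 := hx ((y₀ + y : ℝ) : Torus)
  have hu2 := hx ((y₀ - y : ℝ) : Torus)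
  have hu3 : ν * (u ((y₀ + y : ℝ) : Torus) + u ((y₀ - y : ℝ) : Torus)) ≤
      ν * (2 * u (y₀ : Torus)) := by
    refine mul_le_mul_of_nonneg_left ?_ hν.le
    linarith
  have he : δ / 2 * (1 + ∑' k : ℤ, 1 / (k : ℝ) ^ 2) / (2 * Real.pi) = errorConst * δ := by
    unfold errorConst
    field_simp
    ring
  rw [he] at hZy
  have hy2 : 0 < y ^ 2 := by positivity
  have := mul_lt_mul_of_pos_right hκ1 hy2
  linarith

theorem dx_neg (f : Torus → ℝ) (x : Torus) : dx (fun x => -f x) x = -dx f x := by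
  unfold dx
  exact deriv.fun_neg

theorem flux_neg (f : Torus → ℝ) (x : Torus) : flux (fun x => -f x) x = -flux f x := by
  unfold flux
  rw [dx_neg]
  ring

theorem fhat_neg (f : Torus → ℝ) (k : ℤ) : fhat (fun x => -f x) k = -fhat f k := by
  have := fhat_const_mul (-1) f k
  simpa using this

theorem velocity_neg (ν : ℝ) (f : Torus → ℝ) (k : ℤ) :
    velocity ν (fun x => -f x) k = -velocity ν f k := by
  have : flux (fun x => -f x) = fun x => -flux f x := funext fun x => flux_neg f x
  unfold velocity
  rw [this, fhat_neg, fhat_neg]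
  ring

/-- Where the slope is minimal, the flux is almost at least its mean. -/
theorem le_flux_of_isMin {ν : ℝ} (hν : 0 < ν) {f : Torus → ℝ}
    (hf : ContDiff ℝ 1 (fun y : ℝ => f (y : Torus))) {δ : ℝ} (hδ : 0 < δ)
    (hv : ∀ K, ∑ k ∈ freq K, ‖velocity ν f k‖ ^ 2 ≤ δ ^ 2) {x : Torus}
    (hx : ∀ y, dx f x ≤ dx f y) : meanFlux f - errorConst * δ ≤ flux f x := by
  have h := flux_le_of_isMax hν (f := fun x => -f x) hf.neg hδ (by simpa [velocity_neg] using hv)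
    (x := x) (fun y => by rw [dx_neg, dx_neg]; exact neg_le_neg (hx y))
  have hm : meanFlux (fun x => -f x) = -meanFlux f := by
    unfold meanFlux
    simp only [flux_neg]
    rw [integral_neg, neg_div]
  rw [hm, flux_neg] at h
  linarith

/-! ### Mean flux and slope bounds -/

/-- Testing the equation with u discards ν∫(∂ₓu)² by sign and bounds ∫(u⁴ - u²) by ½∫u² plus a
constant. The quartic then controls the cubic flux pointwise. -/
theorem abs_meanFlux_le {ν : ℝ} (hν : 0 < ν) {f : Torus → ℝ}
    (hf : ContDiff ℝ 1 (fun y : ℝ => f (y : Torus)))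
    (hv : ∀ K, ∑ k ∈ freq K, ‖velocity ν f k‖ ^ 2 ≤ 1) : |meanFlux f| ≤ 4 := by
  have hpi := Real.two_pi_pos
  have hv' := sum_le_of_sum_freq_le (fun k => by positivity) hv
  set u := dx f with hu
  have huc : Continuous u := continuous_dx hf
  have hFc := continuous_flux hf
  have hterm : ∀ k, (conj (fhat u k) * fhat (flux f) k).re ≤
      1 / 2 * (‖fhat u k‖ ^ 2 + ‖velocity ν f k‖ ^ 2) := by
    intro k
    by_cases hk : k = 0
    · subst hk
      have : fhat u 0 = 0 := by rw [hu, fhat_dx hf]; simp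
      rw [this]
      simp
    -- The Fourier coefficient of flux - ν∂ₓ²u, a primitive of the velocity; as |k| ≥ 1, integrating
    -- does not increase the coefficient.
    · set r := fhat (flux f) k + ν * (k : ℝ) ^ 2 * fhat u k with hr
      have h1 : ‖r‖ ≤ ‖velocity ν f k‖ := by
        rw [velocity_eq hf, norm_mul, norm_mul, Complex.norm_I, one_mul, Complex.norm_intCast]
        refine le_mul_of_one_le_left (norm_nonneg _) ?_
        have : 1 ≤ |k| := Int.one_le_abs hk
        exact_mod_cast this
      have h2 : fhat (flux f) k = r + ((-(ν * (k : ℝ) ^ 2) : ℝ) : ℂ) * fhat u k := by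
        rw [hr]; push_cast; ring
      rw [h2, re_conj_mul_add, re_conj_mul_ofReal, re_conj_mul_self]
      have h3 := (le_abs_self _).trans (re_conj_mul_le (fhat u k) r)
      have h4 : 0 ≤ ν * (k : ℝ) ^ 2 * ‖fhat u k‖ ^ 2 := by positivity
      have h5 := mul_le_mul_of_nonneg_left h1 (norm_nonneg (fhat u k))
      nlinarith [sq_nonneg (‖fhat u k‖ - ‖velocity ν f k‖)]
  have hsum : 2 * Real.pi * ∫ x, u x * flux f x ≤
      1 / 2 * (2 * Real.pi * (∫ x, u x ^ 2) + 1) := by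
    refine le_of_tendsto (hasSum_re_conj_fhat_mul huc hFc) (Eventually.of_forall fun S => ?_)
    refine (Finset.sum_le_sum fun k _ => hterm k).trans ?_
    rw [← Finset.mul_sum, Finset.sum_add_distrib]
    gcongr
    · exact sum_sq_norm_fhat_le huc S
    · exact hv' S
  have hpt : ∀ x, |flux f x| ≤ 2 * (u x * flux f x - 1 / 2 * u x ^ 2) + 13 / 4 := by
    intro x
    have e : flux f x = (u x ^ 2 - 1) * u x := rfl
    rw [e, abs_le]
    constructor
    · nlinarith [sq_nonneg (u x ^ 2 - u x / 2 - 1 / 2), sq_nonneg (u x ^ 2 + u x / 2 - 1 / 2),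
        sq_nonneg (u x ^ 2 - 3 / 2), sq_nonneg (u x - 1), sq_nonneg (u x + 1)]
    · nlinarith [sq_nonneg (u x ^ 2 - u x / 2 - 1 / 2), sq_nonneg (u x ^ 2 + u x / 2 - 1 / 2),
        sq_nonneg (u x ^ 2 - 3 / 2), sq_nonneg (u x - 1), sq_nonneg (u x + 1)]
  have hint : |∫ x, flux f x| ≤
      2 * ((∫ x, u x * flux f x) - 1 / 2 * ∫ x, u x ^ 2) + 2 * Real.pi * (13 / 4) := by
    have i1 : Integrable (fun x => u x * flux f x) := integrable_of_continuous (huc.mul hFc)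
    have i2 : Integrable (fun x => 1 / 2 * u x ^ 2) := integrable_of_continuous (by fun_prop)
    have i3 : Integrable (fun x => 2 * (u x * flux f x - 1 / 2 * u x ^ 2)) :=
      (i1.sub i2).const_mul 2
    have i4 : Integrable (fun _ : Torus => (13 / 4 : ℝ)) :=
      integrable_of_continuous continuous_const
    rw [← integral_const_mul, ← integral_sub i1 i2, ← integral_const_mul, ← integral_torus_const,
      ← integral_add i3 i4]
    exact abs_integral_le_integral_abs.trans
      (integral_mono (integrable_of_continuous hFc.abs) (i3.add i4) hpt)
  unfold meanFlux
  rw [abs_div, abs_of_pos hpi, div_le_iff₀ hpi]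
  have h3 : (∫ x, u x * flux f x) - 1 / 2 * ∫ x, u x ^ 2 ≤ 1 / 4 := by
    have : 2 * Real.pi * ((∫ x, u x * flux f x) - 1 / 2 * ∫ x, u x ^ 2) ≤ 1 / 2 := by linarith
    by_contra! hc
    nlinarith [Real.pi_gt_three]
  linarith [Real.pi_gt_three]

theorem exists_isMax_dx {f : Torus → ℝ} (hf : ContDiff ℝ 1 (fun y : ℝ => f (y : Torus))) :
    ∃ x, ∀ y, dx f y ≤ dx f x := by
  obtain ⟨x, -, hx⟩ := isCompact_univ.exists_isMaxOn Set.univ_nonempty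
    (continuous_dx hf).continuousOn
  exact ⟨x, fun y => hx (Set.mem_univ y)⟩

theorem exists_isMin_dx {f : Torus → ℝ} (hf : ContDiff ℝ 1 (fun y : ℝ => f (y : Torus))) :
    ∃ x, ∀ y, dx f x ≤ dx f y := by
  obtain ⟨x, -, hx⟩ := isCompact_univ.exists_isMinOn Set.univ_nonempty
    (continuous_dx hf).continuousOn
  exact ⟨x, fun y => hx (Set.mem_univ y)⟩

/-- Slope bound in terms of bounds on the flux at the extremal points. -/
theorem abs_dx_le_of_flux_le {f : Torus → ℝ} (hf : ContDiff ℝ 1 (fun y : ℝ => f (y : Torus)))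
    {A m : ℝ} (hm : 1 ≤ m) (hA : A ≤ (m ^ 2 - 1) * m)
    (hmax : ∀ x, (∀ y, dx f y ≤ dx f x) → flux f x ≤ A)
    (hmin : ∀ x, (∀ y, dx f x ≤ dx f y) → -A ≤ flux f x) (x : Torus) : |dx f x| ≤ m := by
  have key : ∀ v : ℝ, (v ^ 2 - 1) * v ≤ A → v ≤ m := by
    intro v hv
    by_contra! h
    have h1 : (m ^ 2 - 1) * m < (v ^ 2 - 1) * v := by
      have h2 : 0 < (v - m) * (v ^ 2 + v * m + m ^ 2 - 1) := by
        refine mul_pos (by linarith) ?_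
        nlinarith
      linarith
    linarith
  obtain ⟨x₁, h₁⟩ := exists_isMax_dx hf
  obtain ⟨x₂, h₂⟩ := exists_isMin_dx hf
  have k₁ := key _ (hmax x₁ h₁)
  -- The flux is an odd function of the slope, so the minimum reduces to the same estimate.
  have k₂ := key (-dx f x₂) (by
    have : -A ≤ (dx f x₂ ^ 2 - 1) * dx f x₂ := hmin x₂ h₂
    nlinarith)
  rw [abs_le]
  constructor <;> linarith [h₁ x, h₂ x]

theorem abs_dx_le_two {ν : ℝ} (hν : 0 < ν) {f : Torus → ℝ}
    (hf : ContDiff ℝ 1 (fun y : ℝ => f (y : Torus))) {δ : ℝ} (hδ : 0 < δ) (hδ1 : δ ≤ 1)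
    (hδC : errorConst * δ ≤ 1) (hv : ∀ K, ∑ k ∈ freq K, ‖velocity ν f k‖ ^ 2 ≤ δ ^ 2)
    (x : Torus) : |dx f x| ≤ 2 := by
  have hm := abs_le.1 (abs_meanFlux_le hν hf fun K => (hv K).trans (pow_le_one₀ hδ.le hδ1))
  -- Mean flux at most 4 plus error at most 1, against (2² - 1)·2 = 6.
  refine abs_dx_le_of_flux_le hf (A := 5) one_le_two (by norm_num) (fun x hx => ?_)
    (fun x hx => ?_) x
  · linarith [flux_le_of_isMax hν hf hδ hv hx]
  · linarith [le_flux_of_isMin hν hf hδ hv hx]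

theorem meanFlux_eq_zero_of_even {f : Torus → ℝ} (hf : ∀ x, f (-x) = f x) : meanFlux f = 0 := by
  have h1 : (fun x => f (-x)) = f := funext hf
  have h2 : ∀ x, flux f (-x) = -flux f x := fun x => by
    have := flux_comp_neg f x
    rw [h1] at this
    linarith
  have h3 := integral_neg_eq_self (flux f) (volume : Measure Torus)
  simp only [h2, integral_neg] at h3
  have : ∫ x, flux f x = 0 := by linarith
  rw [meanFlux, this, zero_div]

theorem abs_dx_le_of_even {ν : ℝ} (hν : 0 < ν) {f : Torus → ℝ}
    (hf : ContDiff ℝ 1 (fun y : ℝ => f (y : Torus))) (heven : ∀ x, f (-x) = f x) {δ η : ℝ}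
    (hδ : 0 < δ) (hη : 0 ≤ η) (hδη : errorConst * δ ≤ η)
    (hv : ∀ K, ∑ k ∈ freq K, ‖velocity ν f k‖ ^ 2 ≤ δ ^ 2) (x : Torus) : |dx f x| ≤ 1 + η := by
  have hm := meanFlux_eq_zero_of_even heven
  -- With zero mean only the error remains, and ((1+η)² - 1)(1+η) = 2η + 3η² + η³ ≥ η.
  refine abs_dx_le_of_flux_le hf (A := η) (by linarith) (by nlinarith [pow_nonneg hη 3])
    (fun x hx => ?_) (fun x hx => ?_) x
  · linarith [flux_le_of_isMax hν hf hδ hv hx]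
  · linarith [le_flux_of_isMin hν hf hδ hv hx]

/-! ### Propagation of evenness -/

/-- Continuous functions with the same Fourier coefficients agree. -/
theorem eq_of_fhat_eq {f g : Torus → ℝ} (hf : Continuous f) (hg : Continuous g)
    (h : ∀ k, fhat f k = fhat g k) : f = g := by
  have h1 := hasSum_sq_norm_fhat (hf.sub hg)
  have h2 : ∀ k, fhat (f - g) k = 0 := fun k => by
    rw [fhat_sub (integrable_of_continuous hf) (integrable_of_continuous hg), h, sub_self]
  simp only [h2, norm_zero, ne_eq, OfNat.ofNat_ne_zero, not_false_eq_true, zero_pow] at h1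
  have h3 : ∫ x, (f - g) x ^ 2 = 0 :=
    (mul_eq_zero.1 (h1.unique hasSum_zero)).resolve_left Real.two_pi_pos.ne'
  have hc : Continuous fun x => (f - g) x ^ 2 := (hf.sub hg).pow 2
  rw [integral_eq_zero_iff_of_nonneg (fun x => sq_nonneg _) (integrable_of_continuous hc)] at h3
  have h4 := (hc.ae_eq_iff_eq _ continuous_const).1 h3
  ext x
  have h5 := congrFun h4 x
  simp only [Pi.sub_apply] at h5
  exact sub_eq_zero.1 (pow_eq_zero_iff two_ne_zero |>.1 h5)

theorem sum_sq_norm_fhat_le_of_sobolevENorm_le {s : ℝ} {f : Torus → ℝ} {ε : ℝ} (hε : 0 ≤ ε)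
    (h : sobolevENorm s f ≤ ENNReal.ofReal ε) (S : Finset ℤ) :
    ∑ k ∈ S, ‖fhat f k‖ ^ 2 ≤ ε ^ 2 := by
  unfold sobolevENorm at h
  rw [one_div, ENNReal.rpow_inv_le_iff (by norm_num),
    ENNReal.ofReal_rpow_of_nonneg hε (by norm_num), Real.rpow_ofNat] at h
  have h1 := (ENNReal.sum_le_tsum S).trans h
  rw [← ENNReal.ofReal_sum_of_nonneg fun k _ => by positivity,
    ENNReal.ofReal_le_ofReal_iff (by positivity)] at h1
  refine le_trans (Finset.sum_le_sum fun k _ => ?_) h1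
  refine le_mul_of_one_le_left (by positivity) ?_
  have := Real.rpow_nonneg (abs_nonneg (k : ℝ)) (2 * s)
  linarith

theorem sum_freq_neg (f : ℤ → ℝ) (N : ℕ) : ∑ k ∈ freq N, f (-k) = ∑ k ∈ freq N, f k := by
  refine Finset.sum_nbij' (fun k => -k) (fun k => -k) ?_ ?_ ?_ ?_ ?_ <;> simp [freq] <;> omega

/-- Evenness is propagated by the evolution. -/
theorem IsMildSolution.even {ν : ℝ} (hν : 0 < ν) {h₀ : Torus → ℝ} {h : ℝ → Torus → ℝ}
    (H : IsMildSolution ν h₀ h) (heven : ∀ᵐ x : Torus, h₀ (-x) = h₀ x) {t : ℝ} (ht : 0 < t)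
    (x : Torus) : h t (-x) = h t x := by
  have Hc := H.isClassical
  have hint : ∀ s, 0 ≤ s → Integrable (h s) := fun s hs =>
    (H.continuous_half.1 s hs).1.integrable (by norm_num)
  have h0sym : ∀ k, fhat (h 0) (-k) = fhat (h 0) k := by
    intro k
    rw [fhat_congr_ae H.initial, fhat_congr_ae H.initial, ← fhat_comp_neg]
    exact fhat_congr_ae heven k
  -- The stability estimate needs a positive initial time. Continuity at t = 0 provides one where h
  -- and its reflection are already close in L².
  have hsmall : ∀ ε, 0 < ε → ∃ s, 0 < s ∧ s ≤ t ∧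
      ∀ N, ∑ k ∈ freq N, ‖fhat (h s) k - fhat (h s) (-k)‖ ^ 2 ≤ 4 * ε ^ 2 := by
    intro ε hε
    have h1 := (H.continuous_half.2 0 le_rfl).mono_left
      (nhdsWithin_mono 0 (Set.Ioi_subset_Ici_self (a := (0 : ℝ))))
    have h2 := h1.eventually (gt_mem_nhds (ENNReal.ofReal_pos.2 hε))
    obtain ⟨s, hs1, hs2⟩ := (h2.and (Ioc_mem_nhdsGT ht)).exists
    refine ⟨s, hs2.1, hs2.2, fun N => ?_⟩
    have h3 := sum_sq_norm_fhat_le_of_sobolevENorm_le hε.le hs1.le (freq N)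
    have h4 := (sum_freq_neg (fun k => ‖fhat (h s - h 0) k‖ ^ 2) N).trans_le h3
    calc ∑ k ∈ freq N, ‖fhat (h s) k - fhat (h s) (-k)‖ ^ 2
        ≤ ∑ k ∈ freq N, (2 * ‖fhat (h s - h 0) k‖ ^ 2 + 2 * ‖fhat (h s - h 0) (-k)‖ ^ 2) := by
          refine Finset.sum_le_sum fun k _ => ?_
          have e : fhat (h s) k - fhat (h s) (-k) =
              fhat (h s - h 0) k - fhat (h s - h 0) (-k) := by
            rw [fhat_sub (hint s hs2.1.le) (hint 0 le_rfl),
              fhat_sub (hint s hs2.1.le) (hint 0 le_rfl), h0sym]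
            ring
          rw [e]
          exact sq_norm_sub_le _ _
      _ ≤ _ := by
          rw [Finset.sum_add_distrib, ← Finset.mul_sum, ← Finset.mul_sum]
          linarith
  have hK : ∀ K, ∑ k ∈ freq K, ‖fhat (h t) k - fhat (h t) (-k)‖ ^ 2 ≤ 0 := by
    intro K
    refine le_of_forall_pos_le_add fun ε hε => ?_
    have hE := Real.exp_pos (-(t / (2 * ν)))
    obtain ⟨s, hs, hst, hsN⟩ := hsmall (√(Real.exp (-(t / (2 * ν))) * ε / 4)) (by positivity)
    -- `C` depends on s, so s is fixed while N → ∞; the growth rate 1/(2ν) does not depend on s, and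
    -- ε is sent to 0 afterwards.
    obtain ⟨C, hC0, hC⟩ := Hc.exists_sum_sq_sub_le hν Hc.reflect hs t
    simp only [fhat_comp_neg] at hC
    have hsq : 4 * √(Real.exp (-(t / (2 * ν))) * ε / 4) ^ 2 = Real.exp (-(t / (2 * ν))) * ε := by
      rw [Real.sq_sqrt (by positivity)]; ring
    rw [hsq] at hsN
    have key : Real.exp (-(t / (2 * ν))) *
        ∑ k ∈ freq K, ‖fhat (h t) k - fhat (h t) (-k)‖ ^ 2 ≤ Real.exp (-(t / (2 * ν))) * ε := by
      have hlim : Tendsto (fun N : ℕ => Real.exp (-(t / (2 * ν))) * ε + (t - s) * C / N) atTop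
          (𝓝 (Real.exp (-(t / (2 * ν))) * ε + 0)) :=
        tendsto_const_nhds.add (tendsto_const_div_atTop_nhds_zero_nat _)
      rw [add_zero] at hlim
      refine ge_of_tendsto hlim ?_
      filter_upwards [eventually_ge_atTop (K + 1)] with N hN
      have h1 := hC N (by omega) s t le_rfl hst le_rfl
      have h2 : Real.exp (-(s / (2 * ν))) ≤ 1 := by
        rw [Real.exp_le_one_iff, neg_nonpos]
        positivity
      have h3 : 0 ≤ ∑ k ∈ freq N, ‖fhat (h s) k - fhat (h s) (-k)‖ ^ 2 :=
        Finset.sum_nonneg fun k _ => by positivity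
      have h4 := mul_le_mul_of_nonneg_right h2 h3
      have h5 : ∑ k ∈ freq K, ‖fhat (h t) k - fhat (h t) (-k)‖ ^ 2 ≤
          ∑ k ∈ freq N, ‖fhat (h t) k - fhat (h t) (-k)‖ ^ 2 :=
        Finset.sum_le_sum_of_subset_of_nonneg (freq_mono (by omega)) fun _ _ _ => by positivity
      have h6 := mul_le_mul_of_nonneg_left h5 hE.le
      rw [mul_div_assoc]
      linarith [hsN N]
    rw [zero_add]
    exact le_of_mul_le_mul_left key hE
  have hsym : ∀ k, fhat (h t) (-k) = fhat (h t) k := by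
    intro k
    have h1 := sum_le_of_sum_freq_le (f := fun k => ‖fhat (h t) k - fhat (h t) (-k)‖ ^ 2)
      (fun k => by positivity) hK {k}
    rw [Finset.sum_singleton] at h1
    have h2 : ‖fhat (h t) k - fhat (h t) (-k)‖ = 0 :=
      pow_eq_zero_iff two_ne_zero |>.1 (le_antisymm h1 (by positivity))
    exact (sub_eq_zero.1 (norm_eq_zero.1 h2)).symm
  have hcont := continuous_of_contDiff (H.contDiff t ht)
  exact congrFun (eq_of_fhat_eq (f := fun x => h t (-x)) (hcont.comp continuous_neg) hcont
    fun k => by rw [fhat_comp_neg, hsym]) x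

/-! ### Conclusion: bounds on the limsup -/

theorem eLpNorm_dx_le {f : Torus → ℝ} {C : ℝ} (hf : ∀ x, |dx f x| ≤ C) :
    eLpNorm (dx f) ∞ (volume : Measure Torus) ≤ ENNReal.ofReal C := by
  rw [eLpNorm_exponent_top]
  exact eLpNormEssSup_le_of_ae_bound (Eventually.of_forall hf)

theorem limsupSlope_le {h : ℝ → Torus → ℝ} {C : ℝ} (hC : ∀ᶠ t in atTop, ∀ x, |dx (h t) x| ≤ C) :
    limsupSlope h ≤ ENNReal.ofReal C :=
  limsup_le_of_le (h := hC.mono fun _ ht => eLpNorm_dx_le ht)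

theorem IsClassical.limsupSlope_le_two {ν : ℝ} (hν : 0 < ν) {h : ℝ → Torus → ℝ}
    (H : IsClassical ν h) : limsupSlope h ≤ ENNReal.ofReal 2 := by
  have hC := errorConst_pos
  -- The entry 1 serves the mean flux bound; the other keeps the maximum principle error at most 1.
  set δ := min 1 (1 / errorConst) with hδ
  have hδ0 : 0 < δ := lt_min one_pos (by positivity)
  refine limsupSlope_le ?_
  filter_upwards [H.eventually_sum_sq_velocity_le hν (pow_pos hδ0 2), eventually_gt_atTop 0]
    with t ht ht0
  refine abs_dx_le_two hν (H.contDiff t ht0) hδ0 (min_le_left _ _) ?_ ht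
  calc errorConst * δ ≤ errorConst * (1 / errorConst) := by gcongr; exact min_le_right _ _
    _ = 1 := mul_one_div_cancel hC.ne'

theorem IsMildSolution.limsupSlope_le_one_of_even {ν : ℝ} (hν : 0 < ν) {h₀ : Torus → ℝ}
    {h : ℝ → Torus → ℝ} (H : IsMildSolution ν h₀ h)
    (heven : ∀ᵐ x : Torus, h₀ (-x) = h₀ x) : limsupSlope h ≤ 1 := by
  have hC := errorConst_pos
  refine ENNReal.le_of_forall_pos_le_add fun η hη _ => ?_
  have hη' : (0 : ℝ) < η := hη
  have hδ0 : 0 < (η : ℝ) / errorConst := by positivity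
  have e : (1 : ℝ≥0∞) + η = ENNReal.ofReal (1 + η) := by
    rw [ENNReal.ofReal_add zero_le_one hη'.le, ENNReal.ofReal_one, ENNReal.ofReal_coe_nnreal]
  rw [e]
  refine limsupSlope_le ?_
  filter_upwards [H.isClassical.eventually_sum_sq_velocity_le hν (pow_pos hδ0 2),
    eventually_gt_atTop 0] with t ht ht0
  exact abs_dx_le_of_even hν (H.contDiff t ht0) (H.even hν heven ht0) hδ0 hη'.le
    (mul_div_cancel₀ _ hC.ne').le ht

end ThinFilm

theorem proposition5p2 (ν₀ : ℝ) (hν₀ : 0 < ν₀)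
    (h₀ : ThinFilm.Torus → ℝ) (hH : ThinFilm.MemSobolev (1 / 2) h₀)
    (hmean : ∫ x : ThinFilm.Torus, h₀ x = 0) :
    (∃ K₀ : ℝ, ∀ ν : ℝ, 0 < ν → ν ≤ ν₀ → ∀ h : ℝ → ThinFilm.Torus → ℝ,
      ThinFilm.IsMildSolution ν h₀ h →
        ThinFilm.limsupSlope h ≤ ENNReal.ofReal K₀) ∧
    ((∀ᵐ x : ThinFilm.Torus, h₀ (-x) = h₀ x) →
      ∀ ν : ℝ, 0 < ν → ν ≤ ν₀ → ∀ h : ℝ → ThinFilm.Torus → ℝ,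
        ThinFilm.IsMildSolution ν h₀ h →
          ThinFilm.limsupSlope h ≤ 1) :=
  -- The constant is universal: it depends neither on the data nor on ν₀.
  ⟨⟨2, fun _ hν _ _ H => H.isClassical.limsupSlope_le_two hν⟩,
    fun heven _ hν _ _ H => H.limsupSlope_le_one_of_even hν heven⟩
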